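/- Write $\hat q=q_s+q_d\epsilon$ ($\epsilon^2=0$, $\epsilon$ commuting with everything) for dual complex numbers ($\mathbb{DC}$, $q_s,q_d\in\mathbb C$) and dual quaternions ($\mathbb{DQ}$, $q_s,q_d\in\mathbb Q$, $\mathbb Q$ the real quaternions), with $\hat q^*=q_s^*+q_d^*\epsilon$; the same notation is used for vectors and matrices, entrywise. A vector $\hat x$ is appreciable if $x_s\ne0$. Let $\|\hat x\|_2=\|x_s\|_2+\frac{x_s^*x_d+x_d^*x_s}{2\|x_s\|_2}\epsilon$ for appreciable $\hat x$, and let $\|\hat x\|_{2^R}=\sqrt{\|x_s\|_2^2+\|x_d\|_2^2}$. *Eigenvalues.* $(\hat x,\hat\lambda)$ is an eigenpair of a square dual matrix $\hat A$ if $\hat x$ is appreciable and $\hat A\hat x=\hat x\hat\lambda$. For a dual complex matrix, $\hat x$ and $\hat\lambda$ are dual complex; for a dual quaternion matrix they are dual quaternion. The multiplicity $\mathtt m(\hat\lambda,\hat A)$ is the largest number of eigenvectors belonging to $\hat\lambda$ whose standard parts are right linearly independent, and $\mathtt m_a$ denotes algebraic multiplicity. Two dual numbers $\hat p,\hat q$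 (both in $\mathbb{DC}$, respectively both in $\mathbb{DQ}$) are similar if $\hat u^*\hat p\hat u=\hat q$ for some $\hat u$ of the same kind with $\hat u^*\hat u=1$; in $\mathbb{DC}$ this means $\hat p=\hat q$. An eigenvalue $\hat\lambda$ of $\hat A$ is strictly dominant if $|\lambda_s|>|\mu_s|$ for every eigenvalue $\hat\mu$ of $\hat A$ that is not similar to $\hat\lambda$. *Power method.* For $\hat A\in\mathbb{DC}^{n\times n}$ and $\hat v^{(0)}\in\mathbb{DC}^n$ put $\hat v^{(k+1)}=\hat A\hat v^{(k)}/\|\hat A\hat v^{(k)}\|_2$ and $\hat\lambda^{(k)}=(\hat v^{(k)})^*\hat A\hat v^{(k)}$, without a stopping test. The method breaks down if some $\hat A\hat v^{(k)}$ is not appreciable, and then it does not converge. Otherwise we say that it converges to an eigenpair with eigenvalue $\hat\mu$ if there are eigenvectors $\hat x^{(k)}$ of $\hat A$ belonging to $\hat\mu$ with $\|\hat v^{(k)}-\hat x^{(k)}\|_{2^R}\to0$, and both parts of $\hat\lambda^{(k)}-\hat\mu$ tend to $0$; the convergence is linear if, for a suitable choice of the $\hat x^{(k)}$, all these errors are $O(c^k)$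 for some $0<c<1$. *Adjoint-based power method.* For $\hat A=A_1+A_2\mathbf j\in\mathbb{DQ}^{n\times n}$ with $A_1,A_2$ dual complex let $\mathcal J(\hat A)=\begin{pmatrix}A_1&A_2\\-\overline{A_2}&\overline{A_1}\end{pmatrix}\in\mathbb{DC}^{2n\times2n}$, and let $\mathcal F:\mathbb{DQ}^n\to\mathbb{DC}^{2n}$ be the bijection $v_1+v_2\mathbf j\mapsto(v_1,-\overline{v_2})$. The method runs the power method on $\mathcal J(\hat A)$ from $\hat w^{(0)}=\mathcal F(\hat v^{(0)})$; its output is $\hat v^{(k)}=\mathcal F^{-1}(\hat w^{(k)})$ together with $\hat\lambda^{(k)}=(\hat w^{(k)})^*\mathcal J(\hat A)\hat w^{(k)}\in\mathbb{DC}$. Convergence and linear convergence to an eigenpair of $\hat A$ with eigenvalue $\hat\mu\in\mathbb{DC}$ are defined as above, with eigenvectors $\hat x^{(k)}\in\mathbb{DQ}^n$ of $\hat A$. *Assumptions.* (C) for $\hat A\in\mathbb{DC}^{n\times n}$: $A_s$ has an eigenvalue $\lambda_{1s}$ of modulus larger than that of every other eigenvalue of $A_s$, and $\hat A$ has an eigenvalue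 $\hat\lambda_1=\lambda_{1s}+\lambda_{1d}\epsilon\in\mathbb{DC}$ with $\mathtt m(\hat\lambda_1,\hat A)=\mathtt m_a(\lambda_{1s},A_s)$. (Q) for $\hat A\in\mathbb{DQ}^{n\times n}$: $A_s$ has a real eigenvalue $\lambda_{1s}$ of modulus larger than that of every other right eigenvalue of $A_s$, and $\hat A$ has an eigenvalue $\hat\lambda_1=\lambda_{1s}+\lambda_{1d}\epsilon$ with $\lambda_{1d}\in\mathbb R$ and $\mathtt m(\hat\lambda_1,\hat A)=\mathtt m_a(\lambda_{1s},A_s)$. **Theorem.** Let $n\ge0$. (1) Let $\hat A\in\mathbb{DC}^{n\times n}$ violate (C). Then there are finitely many proper linear subspaces of $\mathbb C^n$ such that, for every $\hat v^{(0)}\in\mathbb{DC}^n$ whose standard part lies in none of them, the power method for $\hat A$ started at $\hat v^{(0)}$ (a) does not converge to an eigenpair whose eigenvalue is strictly dominant; (b) more generally, does not converge to an eigenpair whose eigenvalue $\hat\mu$ is such that only finitely many dual complex eigenvalues of $\hat A$ have the standard part $\mu_s$; (c) does not converge linearly to any eigenpair of $\hat A$. (2) Let $\hat A\in\mathbb{DQ}^{n\times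 n}$ violate (Q). Then there are finitely many proper linear subspaces of $\mathbb C^{2n}$ such that, for every $\hat v^{(0)}\in\mathbb{DQ}^n$ for which the standard part of $\mathcal F(\hat v^{(0)})$ lies in none of them, the conclusions (a), (b), (c) hold for the adjoint-based power method for $\hat A$ started at $\hat v^{(0)}$, with eigenvalues $\hat\mu\in\mathbb{DC}$ of $\hat A$. -/

import Mathlib

open Filter Topology Asymptotics
open scoped Quaternion Matrix

namespace DualPM

section General

variable {R : Type*} [NormedDivisionRing R] [StarRing R] {ι : Type*} [Fintype ι]

/-- The dual element `a + b ε`. -/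
def dmk (a b : R) : DualNumber R := TrivSqZeroExt.inl a + TrivSqZeroExt.inr b

/-- Conjugation `(a + b ε)^* = a^* + b^* ε`. -/
def dconj (q : DualNumber R) : DualNumber R := dmk (star q.fst) (star q.snd)

/-- Standard part of a dual vector. -/
def stVec (x : ι → DualNumber R) : ι → R := fun i => (x i).fst

/-- Dual part of a dual vector. -/
def duVec (x : ι → DualNumber R) : ι → R := fun i => (x i).snd

/-- Standard part of a dual matrix. -/
def stMat (A : Matrix ι ι (DualNumber R)) : Matrix ι ι R := A.map TrivSqZeroExt.fst

/-- A dual vector is appreciable if its standard part is nonzero. -/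
def Appreciable (x : ι → DualNumber R) : Prop := stVec x ≠ 0

/-- `2`-norm of a vector over `R` (`R` will be `ℂ` or `ℍ`). -/
noncomputable def norm2 (x : ι → R) : ℝ := √(∑ i, ‖x i‖ ^ 2)

/-- The real-valued `2^R`-norm of a dual vector. -/
noncomputable def norm2R (x : ι → DualNumber R) : ℝ :=
  √(norm2 (stVec x) ^ 2 + norm2 (duVec x) ^ 2)

/-- The same quantity for a single dual number; used to measure convergence of both parts. -/
noncomputable def magR (q : DualNumber R) : ℝ := √(‖q.fst‖ ^ 2 + ‖q.snd‖ ^ 2)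

/-- `A x = x μ` with `x` appreciable (right eigenpair of a dual matrix). -/
def IsEigenpair (A : Matrix ι ι (DualNumber R)) (x : ι → DualNumber R) (μ : DualNumber R) :
    Prop :=
  Appreciable x ∧ A *ᵥ x = fun i => x i * μ

/-- Right eigenvalue of a dual matrix. -/
def IsEigenvalue (A : Matrix ι ι (DualNumber R)) (μ : DualNumber R) : Prop :=
  ∃ x, IsEigenpair A x μ

/-- Right eigenvalue of a matrix over `R`. -/
def IsStEigenvalue (B : Matrix ι ι R) (μ : R) : Prop :=
  ∃ x : ι → R, x ≠ 0 ∧ B *ᵥ x = fun i => x i * μ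

/-- The multiplicity of `μ`: the largest number of eigenvectors belonging to `μ` whose standard
parts are right linearly independent. The set is bounded by the size of the matrix. -/
noncomputable def multiplicity (A : Matrix ι ι (DualNumber R)) (μ : DualNumber R) : ℕ :=
  sSup {d : ℕ | ∃ x : Fin d → ι → DualNumber R,
    (∀ j, A *ᵥ x j = fun i => x j i * μ) ∧ LinearIndependent Rᵐᵒᵖ (fun j => stVec (x j))}

/-- Similarity `u^* p u = q` by an element `u` with `u^* u = 1` (over `ℂ` this is `p = q`). -/
def Similar (p q : DualNumber R) : Prop :=
  ∃ u : DualNumber R, dconj u * u = 1 ∧ dconj u * p * u = q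

/-- Strict dominant eigenvalue: every eigenvalue that is not similar to `μ` has a standard part of
smaller modulus. -/
def IsStrictDominant (A : Matrix ι ι (DualNumber R)) (μ : DualNumber R) : Prop :=
  IsEigenvalue A μ ∧ ∀ ν, IsEigenvalue A ν → ¬ Similar μ ν → ‖ν.fst‖ < ‖μ.fst‖

/-- The pairs `(v k, lam k)` converge to eigenpairs with eigenvalue `μ`: `lam k → μ`, and `v k`
becomes arbitrarily close to eigenvectors belonging to `μ` (which may change with `k`, for
instance by a phase factor). -/
def ConvergesTo (A : Matrix ι ι (DualNumber R)) (v : ℕ → ι → DualNumber R)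
    (lam : ℕ → DualNumber R) (μ : DualNumber R) : Prop :=
  ∃ x : ℕ → ι → DualNumber R, (∀ k, IsEigenpair A (x k) μ) ∧
    Tendsto (fun k => norm2R (v k - x k)) atTop (𝓝 0) ∧
    Tendsto (fun k => magR (lam k - μ)) atTop (𝓝 0)

/-- The same with a geometric rate. -/
def ConvergesLinearlyTo (A : Matrix ι ι (DualNumber R)) (v : ℕ → ι → DualNumber R)
    (lam : ℕ → DualNumber R) (μ : DualNumber R) : Prop :=
  ∃ x : ℕ → ι → DualNumber R, (∀ k, IsEigenpair A (x k) μ) ∧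
    ∃ c : ℝ, 0 < c ∧ c < 1 ∧
      (fun k => norm2R (v k - x k)) =O[atTop] (fun k : ℕ => c ^ k) ∧
      (fun k => magR (lam k - μ)) =O[atTop] (fun k : ℕ => c ^ k)

end General

section PowerMethod

variable {ι : Type*} [Fintype ι]

open scoped Classical in
/-- The dual-number-valued `2`-norm of a dual complex vector. -/
noncomputable def dualNorm (x : ι → DualNumber ℂ) : DualNumber ℝ :=
  if stVec x = 0 then dmk 0 (norm2 (duVec x))
  else dmk (norm2 (stVec x))
    ((∑ i, (star (stVec x i) * duVec x i + star (duVec x i) * stVec x i)).re /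
      (2 * norm2 (stVec x)))

/-- Dual numbers inside dual complex numbers. -/
noncomputable def ofDualReal (q : DualNumber ℝ) : DualNumber ℂ := dmk (q.fst : ℂ) (q.snd : ℂ)

/-- The vectors of the power method: `v 0` is given and `v (k+1) = A v k / ‖A v k‖₂`. This is
meaningful as long as `A v k` is appreciable, see `NoBreakdown`. -/
noncomputable def pmVec (A : Matrix ι ι (DualNumber ℂ)) (v0 : ι → DualNumber ℂ) :
    ℕ → ι → DualNumber ℂ
  | 0 => v0
  | k + 1 => fun i => (A *ᵥ pmVec A v0 k) i * ofDualReal (dualNorm (A *ᵥ pmVec A v0 k))⁻¹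

/-- The eigenvalue approximations `lam k = (v k)^* (A v k)` of the power method. -/
noncomputable def pmVal (A : Matrix ι ι (DualNumber ℂ)) (v0 : ι → DualNumber ℂ) (k : ℕ) :
    DualNumber ℂ :=
  ∑ i, dconj (pmVec A v0 k i) * (A *ᵥ pmVec A v0 k) i

/-- All divisions in the power method are by invertible dual numbers. -/
def NoBreakdown (A : Matrix ι ι (DualNumber ℂ)) (v0 : ι → DualNumber ℂ) : Prop :=
  ∀ k, Appreciable (A *ᵥ pmVec A v0 k)

/-- The power method runs and converges to eigenpairs with eigenvalue `μ`. -/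
def PMConverges (A : Matrix ι ι (DualNumber ℂ)) (v0 : ι → DualNumber ℂ) (μ : DualNumber ℂ) :
    Prop :=
  NoBreakdown A v0 ∧ ConvergesTo A (pmVec A v0) (pmVal A v0) μ

/-- The power method runs and converges linearly to eigenpairs with eigenvalue `μ`. -/
def PMConvergesLinearly (A : Matrix ι ι (DualNumber ℂ)) (v0 : ι → DualNumber ℂ)
    (μ : DualNumber ℂ) : Prop :=
  NoBreakdown A v0 ∧ ConvergesLinearlyTo A (pmVec A v0) (pmVal A v0) μ

end PowerMethod

section Adjoint

variable {ι : Type*} [Fintype ι]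

/-- Dual complex numbers inside dual quaternions. -/
noncomputable def toDQ (z : DualNumber ℂ) : DualNumber ℍ[ℝ] :=
  dmk (z.fst : ℍ[ℝ]) (z.snd : ℍ[ℝ])

/-- The first dual complex component `z₁` of `z₁ + z₂ j`. -/
noncomputable def dqFst (q : DualNumber ℍ[ℝ]) : DualNumber ℂ :=
  dmk ⟨q.fst.re, q.fst.imI⟩ ⟨q.snd.re, q.snd.imI⟩

/-- The second dual complex component `z₂` of `z₁ + z₂ j`. -/
noncomputable def dqSnd (q : DualNumber ℍ[ℝ]) : DualNumber ℂ :=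
  dmk ⟨q.fst.imJ, q.fst.imK⟩ ⟨q.snd.imJ, q.snd.imK⟩

/-- The quaternion unit `j`. -/
def quatJ : ℍ[ℝ] := ⟨0, 0, 1, 0⟩

/-- The dual complex adjoint matrix: `A₁ + A₂ j ↦ [A₁, A₂; -conj A₂, conj A₁]`. -/
noncomputable def adjMat (A : Matrix ι ι (DualNumber ℍ[ℝ])) :
    Matrix (ι ⊕ ι) (ι ⊕ ι) (DualNumber ℂ) :=
  Matrix.fromBlocks (A.map dqFst) (A.map dqSnd)
    (A.map fun q => -dconj (dqSnd q)) (A.map fun q => dconj (dqFst q))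

/-- The bijection `v₁ + v₂ j ↦ (v₁, -conj v₂)`. -/
noncomputable def adjVec (v : ι → DualNumber ℍ[ℝ]) : ι ⊕ ι → DualNumber ℂ :=
  Sum.elim (fun i => dqFst (v i)) (fun i => -dconj (dqSnd (v i)))

/-- Its inverse `(u₁, u₂) ↦ u₁ - conj u₂ j`. -/
noncomputable def adjVecInv (u : ι ⊕ ι → DualNumber ℂ) : ι → DualNumber ℍ[ℝ] :=
  fun i => toDQ (u (Sum.inl i)) - toDQ (dconj (u (Sum.inr i))) * dmk quatJ 0

/-- The vectors of the adjoint matrix based power method, as dual quaternion vectors. -/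
noncomputable def adjPMVec (A : Matrix ι ι (DualNumber ℍ[ℝ])) (v0 : ι → DualNumber ℍ[ℝ]) (k : ℕ) :
    ι → DualNumber ℍ[ℝ] :=
  adjVecInv (pmVec (adjMat A) (adjVec v0) k)

/-- The (dual complex) eigenvalue approximations of the adjoint matrix based power method. -/
noncomputable def adjPMVal (A : Matrix ι ι (DualNumber ℍ[ℝ])) (v0 : ι → DualNumber ℍ[ℝ]) (k : ℕ) :
    DualNumber ℍ[ℝ] :=
  toDQ (pmVal (adjMat A) (adjVec v0) k)

/-- The adjoint matrix based power method runs and converges to eigenpairs of `A` with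
eigenvalue `μ`. -/
def AdjPMConverges (A : Matrix ι ι (DualNumber ℍ[ℝ])) (v0 : ι → DualNumber ℍ[ℝ])
    (μ : DualNumber ℂ) : Prop :=
  NoBreakdown (adjMat A) (adjVec v0) ∧
    ConvergesTo A (adjPMVec A v0) (adjPMVal A v0) (toDQ μ)

/-- The same with a geometric rate. -/
def AdjPMConvergesLinearly (A : Matrix ι ι (DualNumber ℍ[ℝ])) (v0 : ι → DualNumber ℍ[ℝ])
    (μ : DualNumber ℂ) : Prop :=
  NoBreakdown (adjMat A) (adjVec v0) ∧
    ConvergesLinearlyTo A (adjPMVec A v0) (adjPMVal A v0) (toDQ μ)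

end Adjoint

section Assumptions

variable {ι : Type*} [Fintype ι] [DecidableEq ι]

/-- `A_s` has an eigenvalue `μ_s` larger in modulus than all its other eigenvalues, and some
eigenvalue `μ = μ_s + μ_d ε` of `A` has multiplicity equal to the algebraic multiplicity
of `μ_s`. -/
def ComplexAssumption (A : Matrix ι ι (DualNumber ℂ)) : Prop :=
  ∃ μ : DualNumber ℂ, IsEigenvalue A μ ∧
    (∀ ν : ℂ, IsStEigenvalue (stMat A) ν → ν ≠ μ.fst → ‖ν‖ < ‖μ.fst‖) ∧
    multiplicity A μ = (stMat A).charpoly.rootMultiplicity μ.fst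

/-- The generalized eigenspace of a quaternion matrix at a real number `r`, a right subspace. -/
noncomputable def genEigenspace (B : Matrix ι ι ℍ[ℝ]) (r : ℝ) :
    Submodule ℍ[ℝ]ᵐᵒᵖ (ι → ℍ[ℝ]) where
  carrier := {x | ((B - Matrix.diagonal fun _ => (r : ℍ[ℝ])) ^ Fintype.card ι) *ᵥ x = 0}
  add_mem' {x y} hx hy := by
    simp only [Set.mem_ofPred_eq] at *
    rw [Matrix.mulVec_add, hx, hy, add_zero]
  zero_mem' := by simp
  smul_mem' c x hx := by
    simp only [Set.mem_ofPred_eq] at *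
    rw [Matrix.mulVec_smul, hx, smul_zero]

/-- Algebraic multiplicity of a real number `r` as an eigenvalue of a quaternion matrix: the right
dimension of the generalized eigenspace, which is the total size of the Jordan blocks
belonging to `r`. -/
noncomputable def algMultReal (B : Matrix ι ι ℍ[ℝ]) (r : ℝ) : ℕ :=
  Module.finrank ℍ[ℝ]ᵐᵒᵖ (genEigenspace B r)

/-- `A_s` has a real eigenvalue `r` larger in modulus than all its other eigenvalues, and some
eigenvalue `r + d ε` of `A` with `d` real has multiplicity equal to the algebraic
multiplicity of `r`. -/
def QuaternionAssumption (A : Matrix ι ι (DualNumber ℍ[ℝ])) : Prop :=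
  ∃ r d : ℝ, IsEigenvalue A (dmk (r : ℍ[ℝ]) (d : ℍ[ℝ])) ∧
    (∀ ν : ℍ[ℝ], IsStEigenvalue (stMat A) ν → ν ≠ (r : ℍ[ℝ]) → ‖ν‖ < |r|) ∧
    multiplicity A (dmk (r : ℍ[ℝ]) (d : ℍ[ℝ])) = algMultReal (stMat A) r

end Assumptions

end DualPM

/-! Write `T`, `D` for the standard and dual parts of the matrix. Without breakdown the iterates
have standard parts `u k = a k • T ^ k v`, and everything is decided there. An eigenvector for `l +
d ε` has as standard part an `x` in `ker (T - l)` with `(D - d) x` in `range (T - l)`; these `x`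
form `liftable T D l d`.

Since `T ^ k v ≡ l ^ k v` modulo `range (T - l)`, the number `a k * l ^ k` is the coefficient of `v`
in `u k` modulo that range. Suppose `u k` approaches liftable vectors. If the coefficients do not
tend to zero and `v` avoids finitely many proper subspaces, then `l` is dominant and semisimple and
all its eigenvectors lift (`dominant_of_coeff_not_tendsto`), which is (C).

So if (C) fails, the coefficients tend to zero. By compactness a nonzero limit point `y` is liftable
and lies in `range (T - l)` (`exists_mem_inf_range`). Then `d` may be changed freely without losing
liftability of `y`: every `l + d ε` is an eigenvalue, contrary to (a) and (b). For (c), geometric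
convergence makes `‖T ^ k v‖ / |l| ^ k` bounded, so the coefficients stay away from zero
(`coeff_not_tendsto_zero`), a contradiction.

The quaternion case is the complex one for the adjoint matrix, because (C) for that matrix implies
(Q). Right multiplication by `j` turns eigenvectors for `μ` into eigenvectors for its conjugate;
dominance then makes the standard part of `μ` real, and semisimplicity the dual part. -/

namespace DualPM

/-! ### Algebra of `T - l` and liftable eigenvectors -/

section Operator

variable {V : Type*} [AddCommGroup V] [Module ℂ V]

lemma pow_apply_sub_mem_range (T : Module.End ℂ V) (ν : ℂ) (v : V) (k : ℕ) :
    (T ^ k) v - ν ^ k • v ∈ LinearMap.range (T - ν • 1) := by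
  induction k with
  | zero => simp
  | succ k ih =>
    have h1 : (T - ν • 1) ((T ^ k) v) ∈ LinearMap.range (T - ν • 1) := ⟨_, rfl⟩
    have h2 := Submodule.add_mem _ h1 (Submodule.smul_mem _ ν ih)
    convert h2 using 1
    simp only [pow_succ', Module.End.mul_apply, LinearMap.sub_apply, LinearMap.smul_apply,
      Module.End.one_apply]
    module

lemma ker_pow_le_ker {f : Module.End ℂ V}
    (h : Disjoint (LinearMap.ker f) (LinearMap.range f)) (k : ℕ) :
    LinearMap.ker (f ^ (k + 1)) ≤ LinearMap.ker f := by
  induction k with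
  | zero => simp
  | succ k ih =>
    intro x hx
    have h1 : f x ∈ LinearMap.ker (f ^ (k + 1)) := by
      rwa [LinearMap.mem_ker, ← Module.End.mul_apply, ← pow_succ]
    have := Submodule.disjoint_def.mp h (f x) (ih h1) ⟨x, rfl⟩
    exact this

/-- The standard parts of the eigenvectors of `T + D ε` with eigenvalue `l + d ε`. -/
def liftable (T D : Module.End ℂ V) (l d : ℂ) : Submodule ℂ V :=
  LinearMap.ker (T - l • 1) ⊓ (LinearMap.range (T - l • 1)).comap (D - d • 1)

lemma liftable_le_ker (T D : Module.End ℂ V) (l d : ℂ) :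
    liftable T D l d ≤ LinearMap.ker (T - l • 1) := inf_le_left

lemma maxGenEigenspace_eq_ker {T : Module.End ℂ V} {l : ℂ}
    (h : Disjoint (LinearMap.ker (T - l • 1)) (LinearMap.range (T - l • 1))) :
    T.maxGenEigenspace l = LinearMap.ker (T - l • 1) := by
  apply le_antisymm
  · intro x hx
    obtain ⟨k, hk⟩ := Module.End.mem_maxGenEigenspace _ _ _ |>.mp hx
    exact ker_pow_le_ker h k (by
      rw [LinearMap.mem_ker, pow_succ', Module.End.mul_apply, hk, map_zero])
  · intro x hx
    exact (Module.End.mem_maxGenEigenspace _ _ _).mpr ⟨1, by simpa using hx⟩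

end Operator

/-! ### Asymptotics of normalized orbits and the exceptional subspaces -/

section NormedOperator

variable {V : Type*} [NormedAddCommGroup V] [NormedSpace ℂ V] [FiniteDimensional ℂ V]

/-- A linear functional that vanishes on `F` but not at `v` reads off `b k` from `u k - x k`. -/
lemma coeff_tendsto_zero {F : Submodule ℂ V} {v : V} (hv : v ∉ F) {u x : ℕ → V} {b : ℕ → ℂ}
    (hx : ∀ k, x k ∈ F) (hb : ∀ k, u k - b k • v ∈ F)
    (h : Tendsto (fun k => u k - x k) atTop (𝓝 0)) : Tendsto b atTop (𝓝 0) := by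
  obtain ⟨f, hfv, hf⟩ := Submodule.exists_le_ker_of_notMem hv
  have hc : Continuous f := f.continuous_of_finiteDimensional
  have h1 : Tendsto (fun k => f (u k - x k)) atTop (𝓝 0) := by
    have := (hc.tendsto 0).comp h
    rwa [map_zero] at this
  have h2 : ∀ k, f (u k - x k) = b k * f v := by
    intro k
    have e1 : f (u k - b k • v) = 0 := hf (hb k)
    have e2 : f (x k) = 0 := hf (hx k)
    simp only [map_sub, map_smul, smul_eq_mul, e2, sub_zero] at e1 ⊢
    exact sub_eq_zero.mp e1
  simp only [h2] at h1
  have h3 := h1.mul_const (f v)⁻¹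
  simpa [mul_assoc, mul_inv_cancel₀ hfv] using h3

/-- If the coefficients of a normalized orbit tend to zero, then the subspace it approaches
meets the range of `T - l`. -/
lemma exists_mem_inf_range {T : Module.End ℂ V} {l : ℂ} {v : V} {L : Submodule ℂ V}
    {u x : ℕ → V} {a : ℕ → ℂ} {m : ℝ} (hm : 0 < m) (hu : ∀ k, u k = a k • (T ^ k) v)
    (hum : ∀ k, m ≤ ‖u (k + 1)‖) (huM : ∀ k, ‖u (k + 1)‖ ≤ 1) (hx : ∀ k, x k ∈ L)
    (h : Tendsto (fun k => u k - x k) atTop (𝓝 0))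
    (ha : Tendsto (fun k => a k * l ^ k) atTop (𝓝 0)) :
    ∃ y ∈ L, y ∈ LinearMap.range (T - l • 1) ∧ y ≠ 0 := by
  have : ProperSpace V := FiniteDimensional.proper ℂ V
  -- The shift by one skips the starting vector, which is not normalized.
  obtain ⟨y, -, φ, hφ, hy⟩ := (isCompact_closedBall (0 : V) 1).tendsto_subseq
    (x := fun k => u (k + 1)) (fun k => by simpa using huM k)
  have hφ' : Tendsto (fun k => φ k + 1) atTop atTop :=
    (tendsto_add_atTop_nat 1).comp hφ.tendsto_atTop
  have hy' : Tendsto (fun k => u (φ k + 1)) atTop (𝓝 y) := hy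
  refine ⟨y, ?_, ?_, ?_⟩
  · refine L.closed_of_finiteDimensional.mem_of_tendsto
      (f := fun k => x (φ k + 1)) (b := atTop) ?_ (Eventually.of_forall fun k => hx _)
    simpa using hy'.sub (h.comp hφ')
  · refine (LinearMap.range (T - l • 1)).closed_of_finiteDimensional.mem_of_tendsto
      (f := fun k => u (φ k + 1) - (a (φ k + 1) * l ^ (φ k + 1)) • v) (b := atTop) ?_
      (Eventually.of_forall fun k => ?_)
    · simpa using hy'.sub ((ha.comp hφ').smul_const v)
    · have := Submodule.smul_mem _ (a (φ k + 1)) (pow_apply_sub_mem_range T l v (φ k + 1))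
      simpa only [hu, smul_sub, smul_smul, SetLike.mem_coe] using this
  · have : m ≤ ‖y‖ := ge_of_tendsto hy'.norm (Eventually.of_forall fun k => hum _)
    exact norm_pos_iff.mp (hm.trans_le this)

/-- A normalized orbit of `T` does not approach the kernel of `T`. -/
lemma orbit_not_tendsto_ker {T : Module.End ℂ V} {v : V} {u x : ℕ → V} {a : ℕ → ℂ} {m : ℝ}
    (hm : 0 < m) (hu : ∀ k, u k = a k • (T ^ k) v) (hum : ∀ k, m ≤ ‖u (k + 1)‖)
    (hx : ∀ k, T (x k) = 0) : ¬ Tendsto (fun k => u k - x k) atTop (𝓝 0) := by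
  intro h
  -- Split the characteristic polynomial as `X ^ j * q` with `q(0) ≠ 0`. By Cayley–Hamilton `q(T)`
  -- kills `u k` for `k ≥ j`, so `q(0) • u k` is minus a polynomial in `T` without constant term
  -- applied to `u k`. That operator kills `x k`, which forces `u k → 0`.
  obtain ⟨q, hq, hq0⟩ := Polynomial.exists_eq_pow_rootMultiplicity_mul_and_not_dvd
    T.charpoly T.charpoly_monic.ne_zero 0
  set j := T.charpoly.rootMultiplicity 0
  rw [Polynomial.C_0, sub_zero] at hq hq0
  rw [Polynomial.X_dvd_iff] at hq0
  have hCH : Polynomial.aeval T (Polynomial.X ^ j * q) = 0 := by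
    rw [← hq]; exact T.aeval_self_charpoly
  have hqu : ∀ k, j ≤ k → Polynomial.aeval T q (u k) = 0 := by
    intro k hk
    obtain ⟨i, rfl⟩ := Nat.exists_eq_add_of_le' hk
    have e : Polynomial.aeval T q * T ^ (i + j) = 0 := by
      have : q * Polynomial.X ^ (i + j) = Polynomial.X ^ i * (Polynomial.X ^ j * q) := by ring
      have h2 := congrArg (Polynomial.aeval T) this
      simpa only [map_mul, map_pow, Polynomial.aeval_X, hCH, mul_zero] using h2
    rw [hu, map_smul, ← Module.End.mul_apply, e]; simp
  have hdec : q = Polynomial.divX q * Polynomial.X + Polynomial.C (q.coeff 0) :=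
    (Polynomial.divX_mul_X_add q).symm
  set G : Module.End ℂ V := Polynomial.aeval T (Polynomial.divX q) * T
  have hG : ∀ k, j ≤ k → q.coeff 0 • u k = - G (u k - x k) := by
    intro k hk
    have h1 := hqu k hk
    rw [hdec] at h1
    simp only [map_add, map_mul, Polynomial.aeval_X, Polynomial.aeval_C, LinearMap.add_apply,
      Module.algebraMap_end_apply] at h1
    have h2 : G (x k) = 0 := by simp [G, hx]
    rw [map_sub, h2, sub_zero]
    exact eq_neg_of_add_eq_zero_right h1
  have hGc : Continuous G := G.continuous_of_finiteDimensional
  have h1 : Tendsto (fun k => - G (u k - x k)) atTop (𝓝 0) := by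
    simpa using ((hGc.tendsto 0).comp h).neg
  have h2 : Tendsto (fun k => q.coeff 0 • u k) atTop (𝓝 0) :=
    h1.congr' ((eventually_ge_atTop j).mono fun k hk => (hG k hk).symm)
  have h3 : Tendsto u atTop (𝓝 0) := by
    simpa [smul_smul, inv_mul_cancel₀ hq0] using h2.const_smul (q.coeff 0)⁻¹
  have h4 : Tendsto (fun k => ‖u (k + 1)‖) atTop (𝓝 0) := by
    simpa using (h3.comp (tendsto_add_atTop_nat 1)).norm
  exact absurd (ge_of_tendsto h4 (Eventually.of_forall hum)) (not_le.mpr hm)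

lemma bounded_of_le_one_add_geom {p : ℕ → ℝ} {C c : ℝ} {K : ℕ} (hp : ∀ k, 0 ≤ p k)
    (hc1 : c < 1)
    (h : ∀ k, K ≤ k → p (k + 1) ≤ (1 + C * c ^ k) * p k) (hC : 0 ≤ C) (hc : 0 < c) :
    ∃ M, ∀ k, K ≤ k → p k ≤ M := by
  -- `s k` is the tail of the geometric series from index `k`; it makes `p k * exp (s k)`
  -- nonincreasing.
  set s : ℕ → ℝ := fun k => C * c ^ k / (1 - c)
  have hs : ∀ k, 0 ≤ s k := fun k => by
    have : 0 < 1 - c := by linarith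
    positivity
  have hss : ∀ k, s k = C * c ^ k + s (k + 1) := fun k => by
    have : 1 - c ≠ 0 := by linarith
    simp only [s]; field_simp; ring
  refine ⟨p K * Real.exp (s K), fun k hk => ?_⟩
  have key : p k * Real.exp (s k) ≤ p K * Real.exp (s K) := by
    induction k, hk using Nat.le_induction with
    | base => rfl
    | succ k hk ih =>
      refine le_trans ?_ ih
      rw [hss k, Real.exp_add, ← mul_assoc]
      refine mul_le_mul_of_nonneg_right ?_ (Real.exp_pos _).le
      refine (h k hk).trans ?_
      rw [mul_comm]
      refine mul_le_mul_of_nonneg_left ?_ (hp k)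
      linarith [Real.add_one_le_exp (C * c ^ k)]
  refine le_trans ?_ key
  exact le_mul_of_one_le_right (hp k) (Real.one_le_exp (hs k))

/-- Geometric convergence of a normalized orbit to the eigenspace of `l` keeps the coefficients
away from zero. -/
lemma coeff_not_tendsto_zero {T : Module.End ℂ V} {l : ℂ} {v : V} {u x : ℕ → V} {a : ℕ → ℂ}
    {m c : ℝ} (hm : 0 < m) (hu : ∀ k, u k = a k • (T ^ k) v) (hum : ∀ k, m ≤ ‖u (k + 1)‖)
    (hx : ∀ k, T (x k) = l • x k) (hc : 0 < c) (hc1 : c < 1)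
    (h : (fun k => u k - x k) =O[atTop] fun k : ℕ => c ^ k) :
    ¬ Tendsto (fun k => a k * l ^ k) atTop (𝓝 0) := by
  have hpow : Tendsto (fun k : ℕ => c ^ k) atTop (𝓝 0) :=
    tendsto_pow_atTop_nhds_zero_of_lt_one hc.le hc1
  have hlim : Tendsto (fun k => u k - x k) atTop (𝓝 0) := h.trans_tendsto hpow
  -- The growth estimate below divides by `‖l‖`, so `l = 0` is handled separately.
  rcases eq_or_ne l 0 with rfl | hl
  · exact absurd hlim (orbit_not_tendsto_ker hm hu hum fun k => by simpa using hx k)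
  have ha : ∀ k, a (k + 1) ≠ 0 := fun k h0 => by
    have := hum k
    rw [hu, h0, zero_smul, norm_zero] at this
    exact absurd this (not_le.mpr hm)
  set G : V →L[ℂ] V := LinearMap.toContinuousLinearMap (T - l • 1)
  have hGa : ∀ y, G y = T y - l • y := fun y => by simp [G]
  have hG : (fun k => G (u k)) =O[atTop] fun k : ℕ => c ^ k := by
    have h1 : (fun k => G (u k)) = fun k => G (u k - x k) := by
      ext1 k
      rw [map_sub, hGa (x k), hx, sub_self, sub_zero]
    rw [h1]
    exact (G.isBigO_comp _ _).trans h
  obtain ⟨C, hC, hb⟩ := hG.exists_pos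
  rw [IsBigOWith] at hb
  obtain ⟨K, hK⟩ := eventually_atTop.mp hb
  have hl' : 0 < ‖l‖ := norm_pos_iff.mpr hl
  set p : ℕ → ℝ := fun k => ‖(T ^ k) v‖ / ‖l‖ ^ k
  -- As `T - l` kills `x k`, it sends `u k` to size at most `C * c ^ k`. Dividing by `‖u k‖ ≥ m`
  -- gives a relative defect `C / m * c ^ k` for `T ^ k v`, and by `‖l‖` the growth factor of `p`.
  -- Starting at `K + 1` avoids index `0`, where `m` is no lower bound.
  obtain ⟨M, hM⟩ := bounded_of_le_one_add_geom (p := p) (C := C / (m * ‖l‖)) (c := c) (K := K + 1)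
    (fun k => by positivity) hc1 (by
      intro k hk
      obtain ⟨i, rfl⟩ := Nat.exists_eq_add_of_le' (le_trans (Nat.le_add_left 1 K) hk)
      have h1 := hK (i + 1) (by omega)
      rw [hu, map_smul, norm_smul, hGa, Real.norm_of_nonneg (pow_pos hc _).le,
        ← Module.End.mul_apply, ← pow_succ'] at h1
      have h2 := hum i
      rw [hu, norm_smul] at h2
      have ha' : 0 < ‖a (i + 1)‖ := norm_pos_iff.mpr (ha i)
      set y := (T ^ (i + 1)) v
      have h3 : ‖(T ^ (i + 1 + 1)) v - l • y‖ ≤ C / m * c ^ (i + 1) * ‖y‖ := by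
        refine le_of_mul_le_mul_left ?_ ha'
        refine h1.trans ?_
        have : C * c ^ (i + 1) = C / m * c ^ (i + 1) * m := by field_simp
        rw [this]
        calc C / m * c ^ (i + 1) * m ≤ C / m * c ^ (i + 1) * (‖a (i + 1)‖ * ‖y‖) :=
              mul_le_mul_of_nonneg_left h2 (by positivity)
          _ = _ := by ring
      have h4 : ‖(T ^ (i + 1 + 1)) v‖ ≤ (‖l‖ + C / m * c ^ (i + 1)) * ‖y‖ := by
        calc ‖(T ^ (i + 1 + 1)) v‖ = ‖l • y + ((T ^ (i + 1 + 1)) v - l • y)‖ := by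
              congr 1; abel
          _ ≤ ‖l • y‖ + ‖(T ^ (i + 1 + 1)) v - l • y‖ := norm_add_le _ _
          _ ≤ ‖l‖ * ‖y‖ + C / m * c ^ (i + 1) * ‖y‖ := by
              rw [norm_smul]; gcongr
          _ = _ := by ring
      simp only [p]
      rw [div_le_iff₀ (by positivity)]
      refine h4.trans (le_of_eq ?_)
      rw [pow_succ ‖l‖ (i + 1)]
      field_simp
      rfl) (by positivity) hc
  intro hlim0
  have h5 : Tendsto (fun k => ‖a k * l ^ k‖ * M) atTop (𝓝 0) := by
    simpa using hlim0.norm.mul_const M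
  refine absurd (ge_of_tendsto h5 ((eventually_ge_atTop (K + 1)).mono fun k hk => ?_))
    (not_le.mpr hm)
  obtain ⟨i, rfl⟩ := Nat.exists_eq_add_of_le' (le_trans (Nat.le_add_left 1 K) hk)
  refine (hum i).trans ?_
  have h6 : ‖u (i + 1)‖ = ‖a (i + 1) * l ^ (i + 1)‖ * p (i + 1) := by
    rw [hu, norm_smul, norm_mul, norm_pow]
    simp only [p]
    field_simp
  rw [h6]
  exact mul_le_mul_of_nonneg_left (hM _ hk) (norm_nonneg _)

lemma disjoint_ker_range_of_sup_eq_top {f : Module.End ℂ V}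
    (h : LinearMap.ker f ⊔ LinearMap.range f = ⊤) :
    Disjoint (LinearMap.ker f) (LinearMap.range f) := by
  have h1 := Submodule.finrank_sup_add_finrank_inf_eq (LinearMap.ker f) (LinearMap.range f)
  have h2 := LinearMap.finrank_range_add_finrank_ker f
  rw [h, finrank_top] at h1
  rw [disjoint_iff]
  apply Submodule.finrank_eq_zero.mp
  omega

lemma range_eq_top_of_not_hasEigenvalue {T : Module.End ℂ V} {l : ℂ}
    (h : ¬ T.HasEigenvalue l) : LinearMap.range (T - l • 1) = ⊤ := by
  rw [← LinearMap.ker_eq_bot_iff_range_eq_top]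
  rw [Module.End.hasEigenvalue_iff, not_not, Module.End.eigenspace_def] at h
  exact h

/-- With `Q` the projection onto `ker (T - l)` along `range (T - l)`, a liftable vector for `d`
satisfies `Q D x = d x`. Hence only the finitely many eigenvalues `d` of `Q D` give a nonzero
liftable space. -/
lemma finite_liftable_sup_range {T : Module.End ℂ V} (D : Module.End ℂ V) {l : ℂ}
    (h : LinearMap.ker (T - l • 1) ⊔ LinearMap.range (T - l • 1) = ⊤) :
    (Set.range fun d => liftable T D l d ⊔ LinearMap.range (T - l • 1)).Finite := by
  have hc : IsCompl (LinearMap.ker (T - l • 1)) (LinearMap.range (T - l • 1)) :=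
    ⟨disjoint_ker_range_of_sup_eq_top h, codisjoint_iff.mpr h⟩
  set Q : Module.End ℂ V := (LinearMap.ker (T - l • 1)).subtype ∘ₗ
    Submodule.projectionOnto _ _ hc
  have hQK : ∀ x ∈ LinearMap.ker (T - l • 1), Q x = x := fun x hx => by
    have := Submodule.projectionOnto_apply_left hc ⟨x, hx⟩
    simp only [Q, LinearMap.comp_apply, Submodule.subtype_apply]
    rw [this]
  have hQR : ∀ x ∈ LinearMap.range (T - l • 1), Q x = 0 := fun x hx => by
    simp only [Q, LinearMap.comp_apply]
    rw [(Submodule.projectionOnto_apply_eq_zero_iff hc).mpr hx, map_zero]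
  have hfin : {d : ℂ | (Q * D).HasEigenvalue d}.Finite :=
    Module.End.finite_hasEigenvalue _
  refine ((hfin.image fun d => liftable T D l d ⊔ LinearMap.range (T - l • 1)).union
    (Set.finite_singleton (LinearMap.range (T - l • 1)))).subset ?_
  rintro _ ⟨d, rfl⟩
  by_cases hd : liftable T D l d = ⊥
  · right; simp [hd]
  · left
    refine ⟨d, ?_, rfl⟩
    obtain ⟨x, hx, hx0⟩ := Submodule.exists_mem_ne_zero_of_ne_bot hd
    refine Module.End.hasEigenvalue_of_hasEigenvector (x := x)
      (Module.End.hasEigenvector_iff.mpr ⟨Module.End.mem_eigenspace_iff.mpr ?_, hx0⟩)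
    have h1 : Q ((D - d • 1) x) = 0 := hQR _ hx.2
    simp only [LinearMap.sub_apply, LinearMap.smul_apply, Module.End.one_apply, map_sub, map_smul,
      hQK x hx.1] at h1
    exact sub_eq_zero.mp h1

/-- The proper subspaces that a starting vector has to avoid. -/
def exceptional (T D : Module.End ℂ V) : Set (Submodule ℂ V) :=
  {W | W ≠ ⊤ ∧ ∃ l, W = LinearMap.range (T - l • 1) ∨
    W = LinearMap.ker (T - l • 1) ⊔ LinearMap.range (T - l • 1) ∨
    -- The finiteness over `d` relies on this splitting of the space.
    (LinearMap.ker (T - l • 1) ⊔ LinearMap.range (T - l • 1) = ⊤ ∧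
      ∃ d, W = liftable T D l d ⊔ LinearMap.range (T - l • 1))}

lemma exceptional_finite (T D : Module.End ℂ V) : (exceptional T D).Finite := by
  have hfin : {l : ℂ | T.HasEigenvalue l}.Finite := Module.End.finite_hasEigenvalue _
  refine (hfin.biUnion (t := fun l => {LinearMap.range (T - l • 1)} ∪
    ({LinearMap.ker (T - l • 1) ⊔ LinearMap.range (T - l • 1)} ∪
    {W | LinearMap.ker (T - l • 1) ⊔ LinearMap.range (T - l • 1) = ⊤ ∧
      ∃ d, W = liftable T D l d ⊔ LinearMap.range (T - l • 1)})) fun l _ => ?_).subset ?_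
  · refine (Set.finite_singleton _).union ((Set.finite_singleton _).union ?_)
    by_cases h : LinearMap.ker (T - l • 1) ⊔ LinearMap.range (T - l • 1) = ⊤
    · refine (finite_liftable_sup_range D h).subset ?_
      rintro W ⟨-, d, rfl⟩
      exact ⟨d, rfl⟩
    · simp [h]
  · rintro W ⟨hW, l, hl⟩
    simp only [Set.mem_iUnion]
    refine ⟨l, ?_, hl⟩
    by_contra hev
    have ht := range_eq_top_of_not_hasEigenvalue hev
    apply hW
    rcases hl with rfl | rfl | ⟨-, d, rfl⟩ <;> simp [ht]

/-- If the coefficients do not tend to zero, then `l` is the dominant eigenvalue of `T`, it is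
semisimple, and all its eigenvectors are liftable. -/
lemma dominant_of_coeff_not_tendsto {T D : Module.End ℂ V} {l d : ℂ} {v : V} {u x : ℕ → V}
    {a : ℕ → ℂ} (hv : ∀ W ∈ exceptional T D, v ∉ W) (hu : ∀ k, u k = a k • (T ^ k) v)
    (hx : ∀ k, x k ∈ liftable T D l d) (h : Tendsto (fun k => u k - x k) atTop (𝓝 0))
    (ha : ¬ Tendsto (fun k => a k * l ^ k) atTop (𝓝 0)) :
    (∀ ν, T.HasEigenvalue ν → ν ≠ l → ‖ν‖ < ‖l‖) ∧ liftable T D l d = T.maxGenEigenspace l := by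
  have hmem : ∀ ν k, u k - (a k * ν ^ k) • v ∈ LinearMap.range (T - ν • 1) := fun ν k => by
    simpa only [hu, smul_sub, smul_smul] using
      Submodule.smul_mem _ (a k) (pow_apply_sub_mem_range T ν v k)
  constructor
  · intro ν hν hne
    by_contra hlt
    rw [not_lt] at hlt
    have hR : LinearMap.range (T - ν • 1) ≠ ⊤ := fun ht => by
      rw [← LinearMap.ker_eq_bot_iff_range_eq_top] at ht
      rw [Module.End.hasEigenvalue_iff, Module.End.eigenspace_def] at hν
      exact hν ht
    have hv' := hv _ ⟨hR, ν, Or.inl rfl⟩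
    -- `T - ν` acts on `x k` as the nonzero scalar `l - ν`. So `a k * ν ^ k → 0`, and `‖l‖ ≤ ‖ν‖`
    -- passes this on to `a k * l ^ k`.
    have hxR : ∀ k, x k ∈ LinearMap.range (T - ν • 1) := fun k => by
      refine ⟨(l - ν)⁻¹ • x k, ?_⟩
      have h1 : T (x k) = l • x k := by
        have := (hx k).1
        simpa [sub_eq_zero] using this
      have h2 : l - ν ≠ 0 := sub_ne_zero.mpr hne.symm
      rw [map_smul, LinearMap.sub_apply, h1]
      simp only [LinearMap.smul_apply, Module.End.one_apply]
      rw [← sub_smul, smul_smul, inv_mul_cancel₀ h2, one_smul]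
    have h0 := coeff_tendsto_zero hv' hxR (hmem ν) h
    refine ha (squeeze_zero_norm (fun k => ?_) (by simpa using h0.norm))
    simp only [norm_mul, norm_pow]
    gcongr
  · have hvL : v ∈ liftable T D l d ⊔ LinearMap.range (T - l • 1) := by
      by_contra hv'
      exact ha (coeff_tendsto_zero hv' (fun k => Submodule.mem_sup_left (hx k))
        (fun k => Submodule.mem_sup_right (hmem l k)) h)
    have hK : LinearMap.ker (T - l • 1) ⊔ LinearMap.range (T - l • 1) = ⊤ := by
      by_contra hne
      exact hv _ ⟨hne, l, Or.inr (Or.inl rfl)⟩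
        (sup_le_sup_right (liftable_le_ker T D l d) _ hvL)
    have hL : liftable T D l d ⊔ LinearMap.range (T - l • 1) = ⊤ := by
      by_contra hne
      exact hv _ ⟨hne, l, Or.inr (Or.inr ⟨hK, d, rfl⟩)⟩ hvL
    have hdis := disjoint_ker_range_of_sup_eq_top hK
    rw [maxGenEigenspace_eq_ker hdis]
    refine le_antisymm (liftable_le_ker T D l d) ?_
    intro y hy
    obtain ⟨z, hz, w, hw, rfl⟩ := Submodule.mem_sup.mp (hL ▸ Submodule.mem_top (x := y))
    have hw' : w ∈ LinearMap.ker (T - l • 1) := by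
      simpa using Submodule.sub_mem _ hy (liftable_le_ker T D l d hz)
    rw [Submodule.disjoint_def.mp hdis w hw' hw, add_zero]
    exact hz

end NormedOperator

/-! ### Dual matrices by components; multiplicity as a dimension -/

section DualLinearAlgebra

variable {R : Type*} [NormedDivisionRing R] {ι : Type*} [Fintype ι]

/-- Dual part of a dual matrix. -/
def duMat (A : Matrix ι ι (DualNumber R)) : Matrix ι ι R := A.map TrivSqZeroExt.snd

omit [Fintype ι] in
lemma stVec_dmk (x y : ι → R) : stVec (fun i => dmk (x i) (y i)) = x := by
  ext i; simp [stVec, dmk]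

omit [Fintype ι] in
lemma duVec_dmk (x y : ι → R) : duVec (fun i => dmk (x i) (y i)) = y := by
  ext i; simp [duVec, dmk]

lemma stVec_mulVec (A : Matrix ι ι (DualNumber R)) (X : ι → DualNumber R) :
    stVec (A *ᵥ X) = stMat A *ᵥ stVec X := by
  ext i
  simp [stVec, stMat, Matrix.mulVec, dotProduct, TrivSqZeroExt.fst_sum]

lemma duVec_mulVec (A : Matrix ι ι (DualNumber R)) (X : ι → DualNumber R) :
    duVec (A *ᵥ X) = stMat A *ᵥ duVec X + duMat A *ᵥ stVec X := by
  ext i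
  simp [stVec, duVec, stMat, duMat, Matrix.mulVec, dotProduct, TrivSqZeroExt.snd_sum,
    Finset.sum_add_distrib]

lemma mulVec_eq_iff (A : Matrix ι ι (DualNumber R)) (X : ι → DualNumber R) (μ : DualNumber R) :
    (A *ᵥ X = fun i => X i * μ) ↔ (stMat A *ᵥ stVec X = fun i => stVec X i * μ.fst) ∧
      stMat A *ᵥ duVec X + duMat A *ᵥ stVec X =
        fun i => stVec X i * μ.snd + duVec X i * μ.fst := by
  rw [← stVec_mulVec, ← duVec_mulVec]
  constructor
  · intro h
    rw [h]
    exact ⟨by ext i; simp [stVec], by ext i; simp [stVec, duVec]⟩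
  · rintro ⟨h1, h2⟩
    ext i
    · simpa [stVec] using congrFun h1 i
    · simpa [stVec, duVec] using congrFun h2 i

lemma module_finite_op (R : Type*) [DivisionRing R] : Module.Finite Rᵐᵒᵖ R :=
  Module.Finite.of_surjective (LinearMap.toSpanSingleton Rᵐᵒᵖ R 1)
    fun x => ⟨MulOpposite.op x, by simp⟩

/-- The standard parts of solutions form a subspace, so the attainable numbers of independent ones
are exactly those up to its dimension. -/
lemma multiplicity_eq_finrank {A : Matrix ι ι (DualNumber R)} {μ : DualNumber R}
    {L : Submodule Rᵐᵒᵖ (ι → R)}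
    (hL : ∀ x, x ∈ L ↔ ∃ X, stVec X = x ∧ A *ᵥ X = fun i => X i * μ) :
    multiplicity A μ = Module.finrank Rᵐᵒᵖ L := by
  have : Module.Finite Rᵐᵒᵖ R := module_finite_op R
  have hset : {d : ℕ | ∃ x : Fin d → ι → DualNumber R,
      (∀ j, A *ᵥ x j = fun i => x j i * μ) ∧
        LinearIndependent Rᵐᵒᵖ (fun j => stVec (x j))} = Set.Iic (Module.finrank Rᵐᵒᵖ L) := by
    ext d
    constructor
    · rintro ⟨x, hx, hli⟩
      have hli' : LinearIndependent Rᵐᵒᵖ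
          (fun j => (⟨stVec (x j), (hL _).mpr ⟨x j, rfl, hx j⟩⟩ : L)) :=
        LinearIndependent.of_comp L.subtype hli
      simpa using hli'.fintype_card_le_finrank
    · intro hd
      have hb := (Module.finBasis Rᵐᵒᵖ L).linearIndependent
      have hb' := (hb.map' L.subtype (Submodule.ker_subtype L)).comp _
        (Fin.castLE_injective (Set.mem_Iic.mp hd))
      choose X hX1 hX2 using fun x : L => (hL x).mp x.2
      refine ⟨fun j => X (Module.finBasis Rᵐᵒᵖ L (Fin.castLE hd j)), fun j => hX2 _, ?_⟩
      simp only [hX1]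
      exact hb'
  rw [multiplicity, hset]
  exact csSup_Iic

end DualLinearAlgebra

/-! ### Comparison of the `2`-norm with the sup norm -/

section Norm

variable {R : Type*} [NormedDivisionRing R] {ι : Type*} [Fintype ι]

lemma norm_apply_le_norm2 (x : ι → R) (i : ι) : ‖x i‖ ≤ norm2 x :=
  Real.le_sqrt_of_sq_le
    (Finset.single_le_sum (f := fun i => ‖x i‖ ^ 2) (fun _ _ => sq_nonneg _) (Finset.mem_univ i))

lemma norm2_nonneg (x : ι → R) : 0 ≤ norm2 x := Real.sqrt_nonneg _

lemma norm2_smul (c : ℂ) (x : ι → ℂ) : norm2 (c • x) = ‖c‖ * norm2 x := by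
  simp only [norm2, Pi.smul_apply, norm_smul, mul_pow, ← Finset.mul_sum]
  rw [Real.sqrt_mul (sq_nonneg _), Real.sqrt_sq (norm_nonneg _)]

lemma norm2_pos {x : ι → R} (hx : x ≠ 0) : 0 < norm2 x := by
  obtain ⟨i, hi⟩ := Function.ne_iff.mp hx
  exact (norm_pos_iff.mpr hi).trans_le (norm_apply_le_norm2 x i)

lemma norm_le_norm2 (x : ι → R) : ‖x‖ ≤ norm2 x :=
  (pi_norm_le_iff_of_nonneg (norm2_nonneg x)).mpr (norm_apply_le_norm2 x)

lemma norm2_le (x : ι → R) : norm2 x ≤ √(Fintype.card ι) * ‖x‖ := by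
  rw [← Real.sqrt_sq (norm_nonneg x), ← Real.sqrt_mul (Nat.cast_nonneg _)]
  refine Real.sqrt_le_sqrt ((Finset.sum_le_card_nsmul _ _ (‖x‖ ^ 2) fun i _ => ?_).trans_eq ?_)
  · exact pow_le_pow_left₀ (norm_nonneg _) (norm_le_pi_norm x i) 2
  · simp

lemma norm2_stVec_le_norm2R (x : ι → DualNumber R) : norm2 (stVec x) ≤ norm2R x :=
  Real.le_sqrt_of_sq_le (le_add_of_nonneg_right (sq_nonneg _))

end Norm

/-! ### The dual complex power method -/

section Complex

variable {ι : Type*} [Fintype ι]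

lemma fst_dualNorm {x : ι → DualNumber ℂ} (hx : Appreciable x) :
    (dualNorm x).fst = norm2 (stVec x) := by
  rw [dualNorm, if_neg hx]
  simp [dmk]

lemma stVec_pmVec_succ {A : Matrix ι ι (DualNumber ℂ)} {v0 : ι → DualNumber ℂ}
    (h : NoBreakdown A v0) (k : ℕ) :
    stVec (pmVec A v0 (k + 1)) = ((norm2 (stMat A *ᵥ stVec (pmVec A v0 k)))⁻¹ : ℂ) •
      (stMat A *ᵥ stVec (pmVec A v0 k)) := by
  rw [← stVec_mulVec]
  ext i
  simp only [stVec, pmVec, TrivSqZeroExt.fst_mul, ofDualReal, dmk, TrivSqZeroExt.fst_add,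
    TrivSqZeroExt.fst_inl, TrivSqZeroExt.fst_inr, TrivSqZeroExt.fst_inv, fst_dualNorm (h k),
    Pi.smul_apply, smul_eq_mul, add_zero]
  push_cast
  ring

lemma norm2_stVec_pmVec_succ {A : Matrix ι ι (DualNumber ℂ)} {v0 : ι → DualNumber ℂ}
    (h : NoBreakdown A v0) (k : ℕ) : norm2 (stVec (pmVec A v0 (k + 1))) = 1 := by
  have h1 : stMat A *ᵥ stVec (pmVec A v0 k) ≠ 0 := by
    rw [← stVec_mulVec]; exact h k
  have h2 := norm2_pos h1
  rw [stVec_pmVec_succ h, norm2_smul, norm_inv, Complex.norm_of_nonneg h2.le,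
    inv_mul_cancel₀ h2.ne']

variable [DecidableEq ι]

lemma exists_stVec_pmVec_eq {A : Matrix ι ι (DualNumber ℂ)} {v0 : ι → DualNumber ℂ}
    (h : NoBreakdown A v0) (k : ℕ) :
    ∃ a : ℂ, stVec (pmVec A v0 k) = a • (Matrix.toLin' (stMat A) ^ k) (stVec v0) := by
  induction k with
  | zero => exact ⟨1, by simp [pmVec]⟩
  | succ k ih =>
    obtain ⟨a, ha⟩ := ih
    rw [stVec_pmVec_succ h]
    refine ⟨((norm2 (stMat A *ᵥ stVec (pmVec A v0 k)))⁻¹ : ℂ) * a, ?_⟩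
    rw [mul_smul, pow_succ', Module.End.mul_apply, Matrix.toLin'_apply (stMat A),
      ← Matrix.mulVec_smul _ a, ← ha]

lemma mem_liftable_iff (A : Matrix ι ι (DualNumber ℂ)) (l d : ℂ) (x : ι → ℂ) :
    x ∈ liftable (Matrix.toLin' (stMat A)) (Matrix.toLin' (duMat A)) l d ↔
      ∃ X, stVec X = x ∧ A *ᵥ X = fun i => X i * dmk l d := by
  simp only [mulVec_eq_iff]
  constructor
  · rintro ⟨h1, z, hz⟩
    -- The `ε` part of the eigenvalue equation is `(T - l) X_d = -(D - d) x`, hence the sign.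
    refine ⟨fun i => dmk (x i) (-z i), stVec_dmk _ _, ?_⟩
    rw [stVec_dmk, duVec_dmk x (fun i => -z i)]
    have h1' : stMat A *ᵥ x - l • x = 0 := by simpa using h1
    have hz' : stMat A *ᵥ z - l • z = duMat A *ᵥ x - d • x := by simpa using hz
    have e : (fun i => -z i) = -z := rfl
    constructor
    · ext i
      have := congrFun h1' i
      simp only [Pi.sub_apply, Pi.smul_apply, smul_eq_mul, Pi.zero_apply] at this
      simp only [dmk, TrivSqZeroExt.fst_add, TrivSqZeroExt.fst_inl, TrivSqZeroExt.fst_inr]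
      linear_combination this
    · rw [e, Matrix.mulVec_neg]
      ext i
      have := congrFun hz' i
      simp only [Pi.sub_apply, Pi.smul_apply, smul_eq_mul] at this
      simp only [dmk, TrivSqZeroExt.fst_add, TrivSqZeroExt.fst_inl, TrivSqZeroExt.fst_inr,
        TrivSqZeroExt.snd_add, TrivSqZeroExt.snd_inl, TrivSqZeroExt.snd_inr, Pi.add_apply,
        Pi.neg_apply]
      linear_combination -this
  · rintro ⟨X, rfl, h1, h2⟩
    refine ⟨?_, -duVec X, ?_⟩
    · refine LinearMap.mem_ker.mpr ?_
      ext i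
      have := congrFun h1 i
      simp only [dmk, TrivSqZeroExt.fst_add, TrivSqZeroExt.fst_inl, TrivSqZeroExt.fst_inr] at this
      simp only [LinearMap.sub_apply, Matrix.toLin'_apply, LinearMap.smul_apply,
        Module.End.one_apply, Pi.sub_apply, Pi.smul_apply, smul_eq_mul, Pi.zero_apply]
      linear_combination this
    · ext i
      have := congrFun h2 i
      simp only [dmk, TrivSqZeroExt.fst_add, TrivSqZeroExt.fst_inl, TrivSqZeroExt.fst_inr,
        TrivSqZeroExt.snd_add, TrivSqZeroExt.snd_inl, TrivSqZeroExt.snd_inr, Pi.add_apply] at this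
      rw [map_neg]
      simp only [LinearMap.sub_apply, Matrix.toLin'_apply, LinearMap.smul_apply,
        Module.End.one_apply, Pi.sub_apply, Pi.smul_apply, smul_eq_mul, Pi.neg_apply]
      linear_combination -this

omit [Fintype ι] [DecidableEq ι] in
lemma dmk_fst_snd {R : Type*} [NormedDivisionRing R] (μ : DualNumber R) :
    dmk μ.fst μ.snd = μ := by
  ext <;> simp [dmk]

lemma multiplicity_eq_finrank_liftable (A : Matrix ι ι (DualNumber ℂ)) (μ : DualNumber ℂ) :
    multiplicity A μ = Module.finrank ℂ
      (liftable (Matrix.toLin' (stMat A)) (Matrix.toLin' (duMat A)) μ.fst μ.snd) := by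
  set L := liftable (Matrix.toLin' (stMat A)) (Matrix.toLin' (duMat A)) μ.fst μ.snd with hL
  -- The same set with opposite scalars, since `multiplicity` counts right independence.
  let L' : Submodule ℂᵐᵒᵖ (ι → ℂ) :=
    { carrier := L
      add_mem' := L.add_mem
      zero_mem' := L.zero_mem
      smul_mem' := fun c x hx => by
        have : c • x = c.unop • x := by ext i; simp [mul_comm]
        rw [this]
        exact L.smul_mem _ hx }
  rw [multiplicity_eq_finrank (L := L') (fun x => ?_)]
  · refine congrArg Cardinal.toNat (rank_eq_of_equiv_equiv MulOpposite.unop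
      (AddEquiv.refl L) MulOpposite.unop_bijective fun c x => ?_)
    ext i
    exact mul_comm _ _
  · refine (mem_liftable_iff A μ.fst μ.snd x).trans ?_
    rw [dmk_fst_snd]

lemma isStEigenvalue_iff (B : Matrix ι ι ℂ) (ν : ℂ) :
    IsStEigenvalue B ν ↔ Module.End.HasEigenvalue (Matrix.toLin' B) ν := by
  constructor
  · rintro ⟨x, hx, h⟩
    refine Module.End.hasEigenvalue_of_hasEigenvector (x := x)
      (Module.End.hasEigenvector_iff.mpr ⟨Module.End.mem_eigenspace_iff.mpr ?_, hx⟩)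
    rw [Matrix.toLin'_apply, h]
    ext i; simp [mul_comm]
  · intro h
    obtain ⟨x, hx⟩ := h.exists_hasEigenvector
    refine ⟨x, hx.2, ?_⟩
    have := Module.End.mem_eigenspace_iff.mp hx.1
    rw [Matrix.toLin'_apply] at this
    rw [this]
    ext i; simp [mul_comm]

lemma stVec_mem_liftable {A : Matrix ι ι (DualNumber ℂ)} {X : ι → DualNumber ℂ}
    {μ : DualNumber ℂ} (h : A *ᵥ X = fun i => X i * μ) :
    stVec X ∈ liftable (Matrix.toLin' (stMat A)) (Matrix.toLin' (duMat A)) μ.fst μ.snd :=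
  (mem_liftable_iff A _ _ _).mpr ⟨X, rfl, by rw [dmk_fst_snd]; exact h⟩

/-- If the standard parts of the iterates approach eigenvectors belonging to `μ` although the
assumption is violated, then every dual number with the standard part of `μ` is an eigenvalue,
and the convergence is not linear. -/
lemma exists_exceptional_of_not_complexAssumption {A : Matrix ι ι (DualNumber ℂ)}
    (hA : ¬ ComplexAssumption A) :
    ∃ S : Set (Submodule ℂ (ι → ℂ)), S.Finite ∧ (∀ W ∈ S, W ≠ ⊤) ∧
      ∀ v0 : ι → DualNumber ℂ, (∀ W ∈ S, stVec v0 ∉ W) → NoBreakdown A v0 →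
        ∀ (μ : DualNumber ℂ) (X : ℕ → ι → DualNumber ℂ), (∀ k, IsEigenpair A (X k) μ) →
          Tendsto (fun k => stVec (pmVec A v0 k) - stVec (X k)) atTop (𝓝 0) →
          (∀ d, IsEigenvalue A (dmk μ.fst d)) ∧ ∀ c : ℝ, 0 < c → c < 1 →
            ¬ (fun k => stVec (pmVec A v0 k) - stVec (X k)) =O[atTop] fun k : ℕ => c ^ k := by
  set T : Module.End ℂ (ι → ℂ) := Matrix.toLin' (stMat A) with hT
  set D : Module.End ℂ (ι → ℂ) := Matrix.toLin' (duMat A) with hD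
  refine ⟨exceptional T D, exceptional_finite T D, fun W hW => hW.1, ?_⟩
  intro v0 hv hnb μ X hX hlim
  have hXL : ∀ k, stVec (X k) ∈ liftable T D μ.fst μ.snd := fun k => stVec_mem_liftable (hX k).2
  choose a ha using exists_stVec_pmVec_eq hnb
  -- The iterates have `2`-norm one but the ambient norm is the sup norm; the `+ 1` keeps the
  -- constant positive for an empty index type.
  have hlow : ∀ k, (√(Fintype.card ι) + 1)⁻¹ ≤ ‖stVec (pmVec A v0 (k + 1))‖ := fun k => by
    have h1 := norm2_le (stVec (pmVec A v0 (k + 1)))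
    rw [norm2_stVec_pmVec_succ hnb] at h1
    rw [inv_le_iff_one_le_mul₀ (by positivity)]
    nlinarith [norm_nonneg (stVec (pmVec A v0 (k + 1)))]
  have hup : ∀ k, ‖stVec (pmVec A v0 (k + 1))‖ ≤ 1 := fun k =>
    (norm_le_norm2 _).trans_eq (norm2_stVec_pmVec_succ hnb k)
  have hm : 0 < (√(Fintype.card ι) + 1)⁻¹ := by positivity
  have hzero : Tendsto (fun k => a k * μ.fst ^ k) atTop (𝓝 0) := by
    by_contra hne
    obtain ⟨hdom, hgen⟩ := dominant_of_coeff_not_tendsto hv ha hXL hlim hne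
    refine hA ⟨μ, ⟨X 0, hX 0⟩, fun ν hν => hdom ν ((isStEigenvalue_iff _ _).mp hν), ?_⟩
    rw [multiplicity_eq_finrank_liftable, ← hT, ← hD, hgen,
      LinearMap.finrank_maxGenEigenspace_eq, hT, Matrix.charpoly_toLin']
  constructor
  · intro d
    obtain ⟨y, hyL, hyR, hy0⟩ := exists_mem_inf_range hm ha hlow hup hXL hlim hzero
    have hy : y ∈ liftable T D μ.fst d := by
      -- Replacing `μ.snd` by `d` changes `(D - μ.snd) y` by a multiple of `y`, which itself lies in
      -- the range.
      refine ⟨hyL.1, ?_⟩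
      have h1 := Submodule.add_mem _ (Submodule.mem_comap.mp hyL.2)
        (Submodule.smul_mem _ (μ.snd - d) hyR)
      have h2 : (D - d • 1) y = (D - μ.snd • 1) y + (μ.snd - d) • y := by
        simp only [LinearMap.sub_apply, LinearMap.smul_apply, Module.End.one_apply]
        module
      rw [← h2] at h1
      exact h1
    obtain ⟨Y, hY, hAY⟩ := (mem_liftable_iff A _ _ _).mp hy
    exact ⟨Y, by rw [Appreciable, hY]; exact hy0, hAY⟩
  · intro c hc hc1 hO
    refine coeff_not_tendsto_zero hm ha hlow (fun k => ?_) hc hc1 hO hzero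
    have := (hXL k).1
    exact sub_eq_zero.mp (LinearMap.mem_ker.mp this)

end Complex

/-! ### Complex components of dual quaternions -/

section Components

lemma fst_dmk {R : Type*} [NormedDivisionRing R] (a b : R) : (dmk a b).fst = a := by simp [dmk]

lemma snd_dmk {R : Type*} [NormedDivisionRing R] (a b : R) : (dmk a b).snd = b := by simp [dmk]

lemma dqFst_add (p q : DualNumber ℍ[ℝ]) : dqFst (p + q) = dqFst p + dqFst q := by
  refine TrivSqZeroExt.ext (Complex.ext ?_ ?_) (Complex.ext ?_ ?_) <;>
    simp [dqFst, fst_dmk, snd_dmk]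

lemma dqSnd_add (p q : DualNumber ℍ[ℝ]) : dqSnd (p + q) = dqSnd p + dqSnd q := by
  refine TrivSqZeroExt.ext (Complex.ext ?_ ?_) (Complex.ext ?_ ?_) <;>
    simp [dqSnd, fst_dmk, snd_dmk]

lemma dqFst_zero : dqFst 0 = 0 := by
  refine TrivSqZeroExt.ext (Complex.ext ?_ ?_) (Complex.ext ?_ ?_) <;>
    simp [dqFst, fst_dmk, snd_dmk]

lemma dqSnd_zero : dqSnd 0 = 0 := by
  refine TrivSqZeroExt.ext (Complex.ext ?_ ?_) (Complex.ext ?_ ?_) <;>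
    simp [dqSnd, fst_dmk, snd_dmk]

lemma dqFst_sum {κ : Type*} (s : Finset κ) (f : κ → DualNumber ℍ[ℝ]) :
    dqFst (∑ i ∈ s, f i) = ∑ i ∈ s, dqFst (f i) :=
  map_sum (⟨⟨dqFst, dqFst_zero⟩, dqFst_add⟩ : DualNumber ℍ[ℝ] →+ DualNumber ℂ) f s

lemma dqSnd_sum {κ : Type*} (s : Finset κ) (f : κ → DualNumber ℍ[ℝ]) :
    dqSnd (∑ i ∈ s, f i) = ∑ i ∈ s, dqSnd (f i) :=
  map_sum (⟨⟨dqSnd, dqSnd_zero⟩, dqSnd_add⟩ : DualNumber ℍ[ℝ] →+ DualNumber ℂ) f s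

lemma dqFst_mul (p q : DualNumber ℍ[ℝ]) :
    dqFst (p * q) = dqFst p * dqFst q - dqSnd p * dconj (dqSnd q) := by
  refine TrivSqZeroExt.ext (Complex.ext ?_ ?_) (Complex.ext ?_ ?_) <;>
    simp [dqFst, dqSnd, dconj, fst_dmk, snd_dmk] <;> ring

lemma dqSnd_mul (p q : DualNumber ℍ[ℝ]) :
    dqSnd (p * q) = dqFst p * dqSnd q + dqSnd p * dconj (dqFst q) := by
  refine TrivSqZeroExt.ext (Complex.ext ?_ ?_) (Complex.ext ?_ ?_) <;>
    simp [dqFst, dqSnd, dconj, fst_dmk, snd_dmk] <;> ring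

lemma dconj_add (p q : DualNumber ℂ) : dconj (p + q) = dconj p + dconj q := by
  ext <;> simp [dconj, fst_dmk, snd_dmk]

lemma dconj_zero : dconj (0 : DualNumber ℂ) = 0 := by
  ext <;> simp [dconj, fst_dmk, snd_dmk]

lemma dconj_sum {κ : Type*} (s : Finset κ) (f : κ → DualNumber ℂ) :
    dconj (∑ i ∈ s, f i) = ∑ i ∈ s, dconj (f i) :=
  map_sum (⟨⟨dconj, dconj_zero⟩, dconj_add⟩ : DualNumber ℂ →+ DualNumber ℂ) f s

lemma dconj_mul (p q : DualNumber ℂ) : dconj (p * q) = dconj p * dconj q := by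
  ext <;> simp [dconj, fst_dmk, snd_dmk]

lemma dconj_dconj (p : DualNumber ℂ) : dconj (dconj p) = p := by
  ext <;> simp [dconj, fst_dmk, snd_dmk]

lemma dqFst_toDQ (z : DualNumber ℂ) : dqFst (toDQ z) = z := by
  ext <;> simp [dqFst, toDQ, fst_dmk, snd_dmk]

lemma dqSnd_toDQ (z : DualNumber ℂ) : dqSnd (toDQ z) = 0 := by
  refine TrivSqZeroExt.ext (Complex.ext ?_ ?_) (Complex.ext ?_ ?_) <;>
    simp [dqSnd, toDQ, fst_dmk, snd_dmk]

lemma quatJ_re : quatJ.re = 0 := rfl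

lemma quatJ_imI : quatJ.imI = 0 := rfl

lemma quatJ_imJ : quatJ.imJ = 1 := rfl

lemma quatJ_imK : quatJ.imK = 0 := rfl

lemma toDQ_mul_quatJ (z : DualNumber ℂ) :
    toDQ z * dmk quatJ 0 = dmk quatJ 0 * toDQ (dconj z) := by
  ext <;> simp [toDQ, dconj, fst_dmk, snd_dmk, quatJ_re, quatJ_imI,
      quatJ_imJ, quatJ_imK]

end Components

/-! ### Transfer between a quaternion matrix and its adjoint -/

section AdjointMap

variable {ι : Type*}

lemma adjVec_adjVecInv (u : ι ⊕ ι → DualNumber ℂ) : adjVec (adjVecInv u) = u := by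
  funext i
  rcases i with i | i <;> refine TrivSqZeroExt.ext (Complex.ext ?_ ?_) (Complex.ext ?_ ?_) <;>
    simp [adjVec, adjVecInv, dqFst, dqSnd, toDQ, dconj, fst_dmk, snd_dmk, quatJ_re, quatJ_imI,
      quatJ_imJ, quatJ_imK]

lemma adjVecInv_adjVec (x : ι → DualNumber ℍ[ℝ]) : adjVecInv (adjVec x) = x := by
  funext i
  ext <;> simp [adjVec, adjVecInv, dqFst, dqSnd, toDQ, dconj, fst_dmk, snd_dmk, quatJ_re, quatJ_imI,
      quatJ_imJ, quatJ_imK]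

lemma adjVec_injective : Function.Injective (adjVec (ι := ι)) :=
  Function.LeftInverse.injective adjVecInv_adjVec

lemma adjVec_sub (x y : ι → DualNumber ℍ[ℝ]) : adjVec (x - y) = adjVec x - adjVec y := by
  funext i
  rcases i with i | i <;> refine TrivSqZeroExt.ext (Complex.ext ?_ ?_) (Complex.ext ?_ ?_) <;>
    simp [adjVec, dqFst, dqSnd, dconj, fst_dmk, snd_dmk]
  all_goals ring

lemma adjVec_mul_toDQ (x : ι → DualNumber ℍ[ℝ]) (μ : DualNumber ℂ) :
    adjVec (fun i => x i * toDQ μ) = fun i => adjVec x i * μ := by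
  funext i
  rcases i with i | i
  · simp [adjVec, dqFst_mul, dqFst_toDQ, dqSnd_toDQ, dconj_zero]
  · simp [adjVec, dqSnd_mul, dqFst_toDQ, dqSnd_toDQ, dconj_mul, dconj_dconj]

/-- The standard part of `adjVec`. -/
noncomputable def stAdjVec (x : ι → ℍ[ℝ]) : ι ⊕ ι → ℂ :=
  Sum.elim (fun i => ⟨(x i).re, (x i).imI⟩) (fun i => -star ⟨(x i).imJ, (x i).imK⟩)

lemma stVec_adjVec (x : ι → DualNumber ℍ[ℝ]) : stVec (adjVec x) = stAdjVec (stVec x) := by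
  funext i
  rcases i with i | i <;> simp [stVec, adjVec, stAdjVec, dqFst, dqSnd, dconj, fst_dmk]

lemma stAdjVec_eq_zero_iff (x : ι → ℍ[ℝ]) : stAdjVec x = 0 ↔ x = 0 := by
  constructor
  · intro h
    funext i
    have h1 := congrFun h (Sum.inl i)
    have h2 := congrFun h (Sum.inr i)
    simp only [stAdjVec, Sum.elim_inl, Sum.elim_inr, Pi.zero_apply, Complex.ext_iff] at h1 h2
    ext <;> simp_all
  · rintro rfl
    funext i
    rcases i with i | i <;> simp [stAdjVec, Complex.ext_iff]

lemma stAdjVec_injective : Function.Injective (stAdjVec (ι := ι)) := by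
  intro x y h
  rw [← sub_eq_zero, ← stAdjVec_eq_zero_iff]
  have : stAdjVec (x - y) = stAdjVec x - stAdjVec y := by
    funext i
    rcases i with i | i <;> refine Complex.ext ?_ ?_ <;> simp [stAdjVec] <;> ring
  rw [this, h, sub_self]

lemma stAdjVec_sub_mul_coe (x y : ι → ℍ[ℝ]) (r : ℝ) :
    stAdjVec (fun i => y i - (r : ℍ[ℝ]) * x i) = stAdjVec y - (r : ℂ) • stAdjVec x := by
  funext i
  rcases i with i | i <;> refine Complex.ext ?_ ?_ <;> simp [stAdjVec] <;> ring

lemma stAdjVec_mul_coe (x : ι → ℍ[ℝ]) (z : ℂ) :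
    stAdjVec (fun i => x i * (z : ℍ[ℝ])) = fun i => stAdjVec x i * z := by
  funext i
  rcases i with i | i <;> refine Complex.ext ?_ ?_ <;> simp [stAdjVec]
  all_goals ring

variable [Fintype ι]

lemma norm_stAdjVec_le (x : ι → ℍ[ℝ]) : ‖stAdjVec x‖ ≤ norm2 x := by
  refine (pi_norm_le_iff_of_nonneg (norm2_nonneg x)).mpr fun i => ?_
  have key : ∀ (q : ℍ[ℝ]) (z : ℂ), z.re ^ 2 + z.im ^ 2 ≤
      q.re ^ 2 + q.imI ^ 2 + q.imJ ^ 2 + q.imK ^ 2 → ‖z‖ ≤ ‖q‖ := fun q z h => by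
    refine le_of_sq_le_sq ?_ (norm_nonneg q)
    rw [sq ‖q‖, ← Quaternion.normSq_eq_norm_mul_self, Quaternion.normSq_def', Complex.sq_norm,
      Complex.normSq_apply]
    linarith
  rcases i with i | i
  · refine (key (x i) _ ?_).trans (norm_apply_le_norm2 x i)
    simp only [stAdjVec, Sum.elim_inl]
    nlinarith [sq_nonneg (x i).imJ, sq_nonneg (x i).imK]
  · refine (key (x i) _ ?_).trans (norm_apply_le_norm2 x i)
    simp only [stAdjVec, Sum.elim_inr, Complex.neg_re, Complex.neg_im, Complex.star_def,
      Complex.conj_re, Complex.conj_im]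
    nlinarith [sq_nonneg (x i).re, sq_nonneg (x i).imI]

lemma adjMat_mulVec_adjVec (A : Matrix ι ι (DualNumber ℍ[ℝ])) (x : ι → DualNumber ℍ[ℝ]) :
    adjMat A *ᵥ adjVec x = adjVec (A *ᵥ x) := by
  funext i
  rcases i with i | i
  · simp only [adjMat, adjVec, Matrix.mulVec, dotProduct, Fintype.sum_sum_type,
      Matrix.fromBlocks_apply₁₁, Matrix.fromBlocks_apply₁₂, Matrix.map_apply, Sum.elim_inl,
      Sum.elim_inr, dqFst_sum, dqFst_mul, mul_neg, Finset.sum_neg_distrib, Finset.sum_add_distrib,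
      sub_eq_add_neg]
  · simp only [adjMat, adjVec, Matrix.mulVec, dotProduct, Fintype.sum_sum_type,
      Matrix.fromBlocks_apply₂₁, Matrix.fromBlocks_apply₂₂, Matrix.map_apply, Sum.elim_inl,
      Sum.elim_inr, dqSnd_sum, dqSnd_mul, dconj_sum, dconj_add, dconj_mul, dconj_dconj,
      Finset.sum_add_distrib, mul_neg, neg_mul, Finset.sum_neg_distrib]
    abel

lemma stMat_adjMat_mulVec_stAdjVec (A : Matrix ι ι (DualNumber ℍ[ℝ])) (x : ι → ℍ[ℝ]) :
    stMat (adjMat A) *ᵥ stAdjVec x = stAdjVec (stMat A *ᵥ x) := by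
  have h := congrArg stVec (adjMat_mulVec_adjVec A fun i => dmk (x i) 0)
  rwa [stVec_mulVec, stVec_adjVec, stVec_adjVec, stVec_mulVec,
    stVec_dmk x (fun _ => 0)] at h

lemma adjMat_mulVec_eq_iff (A : Matrix ι ι (DualNumber ℍ[ℝ])) (x : ι → DualNumber ℍ[ℝ])
    (μ : DualNumber ℂ) :
    (adjMat A *ᵥ adjVec x = fun i => adjVec x i * μ) ↔ A *ᵥ x = fun i => x i * toDQ μ := by
  rw [adjMat_mulVec_adjVec, ← adjVec_mul_toDQ, adjVec_injective.eq_iff]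

lemma isEigenpair_adjMat_iff (A : Matrix ι ι (DualNumber ℍ[ℝ])) (x : ι → DualNumber ℍ[ℝ])
    (μ : DualNumber ℂ) :
    IsEigenpair (adjMat A) (adjVec x) μ ↔ IsEigenpair A x (toDQ μ) := by
  rw [IsEigenpair, IsEigenpair, adjMat_mulVec_eq_iff, Appreciable, Appreciable, stVec_adjVec,
    ne_eq, stAdjVec_eq_zero_iff]

lemma isEigenvalue_adjMat_iff (A : Matrix ι ι (DualNumber ℍ[ℝ])) (μ : DualNumber ℂ) :
    IsEigenvalue (adjMat A) μ ↔ IsEigenvalue A (toDQ μ) := by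
  constructor
  · rintro ⟨u, hu⟩
    rw [← adjVec_adjVecInv u] at hu
    exact ⟨_, (isEigenpair_adjMat_iff A _ μ).mp hu⟩
  · rintro ⟨x, hx⟩
    exact ⟨_, (isEigenpair_adjMat_iff A x μ).mpr hx⟩

lemma mulVec_mul_right {R : Type*} [Ring R] (M : Matrix ι ι R) (x : ι → R) (q : R) :
    (M *ᵥ fun i => x i * q) = fun i => (M *ᵥ x) i * q := by
  funext i
  simp [Matrix.mulVec, dotProduct, Finset.sum_mul, mul_assoc]

lemma isEigenpair_mul_quatJ {A : Matrix ι ι (DualNumber ℍ[ℝ])} {x : ι → DualNumber ℍ[ℝ]}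
    {μ : DualNumber ℂ} (h : IsEigenpair A x (toDQ μ)) :
    IsEigenpair A (fun i => x i * dmk quatJ 0) (toDQ (dconj μ)) := by
  constructor
  · obtain ⟨i, hi⟩ := Function.ne_iff.mp h.1
    refine Function.ne_iff.mpr ⟨i, ?_⟩
    have hJ : quatJ ≠ 0 := fun h0 => by
      have := congrArg QuaternionAlgebra.imJ h0
      simp [quatJ] at this
    simpa [stVec, fst_dmk, hJ] using hi
  · rw [mulVec_mul_right, h.2]
    simp only [mul_assoc, toDQ_mul_quatJ]

omit [Fintype ι] in
lemma norm_coeComplex (z : ℂ) : ‖(z : ℍ[ℝ])‖ = ‖z‖ := by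
  rw [← sq_eq_sq₀ (norm_nonneg _) (norm_nonneg _), sq ‖(z : ℍ[ℝ])‖,
    ← Quaternion.normSq_eq_norm_mul_self, Quaternion.normSq_def', Complex.sq_norm,
    Complex.normSq_apply]
  simp
  ring

lemma exists_complex_conj (ν : ℍ[ℝ]) : ∃ (q : ℍ[ℝ]) (z : ℂ), q ≠ 0 ∧ ν * q = q * (z : ℍ[ℝ]) := by
  set t : ℝ := √(ν.imI ^ 2 + ν.imJ ^ 2 + ν.imK ^ 2)
  have ht : t ^ 2 = ν.imI ^ 2 + ν.imJ ^ 2 + ν.imK ^ 2 := Real.sq_sqrt (by positivity)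
  -- With `w` the imaginary part of `ν` and `t = |w|`, take `q = w + t i`: from `w² = -t²` follows
  -- `w q = q (t i)`. If `q = 0`, then `ν` is already complex.
  set q : ℍ[ℝ] := ⟨0, ν.imI + t, ν.imJ, ν.imK⟩
  by_cases hq : q = 0
  · refine ⟨1, ⟨ν.re, ν.imI⟩, one_ne_zero, ?_⟩
    have h2 : ν.imJ = 0 := congrArg QuaternionAlgebra.imJ hq
    have h3 : ν.imK = 0 := congrArg QuaternionAlgebra.imK hq
    ext <;> simp [h2, h3]
  · refine ⟨q, ⟨ν.re, t⟩, hq, ?_⟩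
    have h0 : q.re = 0 := rfl
    have h1 : q.imI = ν.imI + t := rfl
    have h2 : q.imJ = ν.imJ := rfl
    have h3 : q.imK = ν.imK := rfl
    ext <;> simp only [Quaternion.re_mul, Quaternion.imI_mul, Quaternion.imJ_mul,
      Quaternion.imK_mul, Quaternion.re_coeComplex, Quaternion.imI_coeComplex,
      Quaternion.imJ_coeComplex, Quaternion.imK_coeComplex, h0, h1, h2, h3]
    · linear_combination ht
    all_goals ring

lemma exists_isStEigenvalue_adjMat {A : Matrix ι ι (DualNumber ℍ[ℝ])} {ν : ℍ[ℝ]}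
    (h : IsStEigenvalue (stMat A) ν) (r : ℝ) (hr : ν ≠ r) :
    ∃ z : ℂ, IsStEigenvalue (stMat (adjMat A)) z ∧ ‖z‖ = ‖ν‖ ∧ z ≠ r := by
  obtain ⟨x, hx, hν⟩ := h
  obtain ⟨q, z, hq, hqz⟩ := exists_complex_conj ν
  refine ⟨z, ⟨stAdjVec fun i => x i * q, ?_, ?_⟩, ?_, ?_⟩
  · rw [ne_eq, stAdjVec_eq_zero_iff]
    obtain ⟨i, hi⟩ := Function.ne_iff.mp hx
    exact Function.ne_iff.mpr ⟨i, mul_ne_zero hi hq⟩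
  · rw [stMat_adjMat_mulVec_stAdjVec, ← stAdjVec_mul_coe, mulVec_mul_right, hν]
    simp only [mul_assoc, hqz]
  · have := congrArg norm hqz
    rw [norm_mul, norm_mul, mul_comm, norm_coeComplex] at this
    exact (mul_left_cancel₀ (norm_ne_zero_iff.mpr hq) this).symm
  -- Real numbers are central, so only `r` itself is conjugate to `r`.
  · rintro rfl
    rw [Quaternion.coeComplex_coe, ← Quaternion.coe_commutes] at hqz
    exact hr (mul_right_cancel₀ hq hqz)

variable [DecidableEq ι]

lemma stAdjVec_pow_mulVec (A : Matrix ι ι (DualNumber ℍ[ℝ])) (r : ℝ) (k : ℕ) (x : ι → ℍ[ℝ]) :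
    stAdjVec (((stMat A - Matrix.diagonal fun _ => (r : ℍ[ℝ])) ^ k) *ᵥ x) =
      ((Matrix.toLin' (stMat (adjMat A)) - (r : ℂ) • (1 : Module.End ℂ (ι ⊕ ι → ℂ))) ^ k)
        (stAdjVec x) := by
  induction k with
  | zero => simp
  | succ k ih =>
    rw [pow_succ', pow_succ', Module.End.mul_apply, ← ih, ← Matrix.mulVec_mulVec]
    set y := ((stMat A - Matrix.diagonal fun _ => (r : ℍ[ℝ])) ^ k) *ᵥ x
    have e : (stMat A - Matrix.diagonal fun _ => (r : ℍ[ℝ])) *ᵥ y =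
        fun i => (stMat A *ᵥ y) i - (r : ℍ[ℝ]) * y i := by
      funext i
      rw [Matrix.sub_mulVec, Pi.sub_apply, Matrix.mulVec_diagonal]
    rw [e, stAdjVec_sub_mul_coe, LinearMap.sub_apply, Matrix.toLin'_apply,
      stMat_adjMat_mulVec_stAdjVec, LinearMap.smul_apply, Module.End.one_apply]

/-- The assumption for the adjoint matrix implies the one for the quaternion matrix. -/
lemma quaternionAssumption_of_complexAssumption_adjMat {A : Matrix ι ι (DualNumber ℍ[ℝ])}
    (h : ComplexAssumption (adjMat A)) : QuaternionAssumption A := by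
  obtain ⟨μ, hμ, hdom, hmult⟩ := h
  set T : Module.End ℂ (ι ⊕ ι → ℂ) := Matrix.toLin' (stMat (adjMat A)) with hT
  set D : Module.End ℂ (ι ⊕ ι → ℂ) := Matrix.toLin' (duMat (adjMat A)) with hD
  have hle : liftable T D μ.fst μ.snd ≤ T.maxGenEigenspace μ.fst := fun x hx =>
    (Module.End.mem_maxGenEigenspace _ _ _).mpr ⟨1, by simpa using hx.1⟩
  have hL : liftable T D μ.fst μ.snd = T.maxGenEigenspace μ.fst := by
    refine Submodule.eq_of_le_of_finrank_eq hle ?_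
    rw [hT, hD, ← multiplicity_eq_finrank_liftable, hmult, LinearMap.finrank_maxGenEigenspace_eq,
      Matrix.charpoly_toLin']
  obtain ⟨x, hx⟩ := (isEigenvalue_adjMat_iff A μ).mp hμ
  have hxJ := (isEigenpair_adjMat_iff A _ _).mpr (isEigenpair_mul_quatJ hx)
  set y := adjVec fun i => x i * dmk quatJ 0
  have hyL := stVec_mem_liftable hxJ.2
  have hfst : (dconj μ).fst = star μ.fst := fst_dmk _ _
  have hsnd : (dconj μ).snd = star μ.snd := snd_dmk _ _
  have hreal : star μ.fst = μ.fst := by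
    by_contra hne
    refine lt_irrefl ‖μ.fst‖ ?_
    have := hdom (star μ.fst) ⟨stVec y, hxJ.1, by
      rw [← hfst]; exact ((mulVec_eq_iff _ _ _).mp hxJ.2).1⟩ hne
    rwa [norm_star] at this
  rw [hfst, hsnd, hreal, ← hT, ← hD] at hyL
  have hyG : stVec y ∈ liftable T D μ.fst μ.snd := by
    rw [hL]
    exact (Module.End.mem_maxGenEigenspace _ _ _).mpr ⟨1, by simpa using hyL.1⟩
  have hsnd_real : star μ.snd = μ.snd := by
    by_contra hne
    -- `stVec y` lifts both for `μ.snd` and for its conjugate; subtracting puts a nonzero multiple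
    -- of it in the range. Its preimage `z` is a generalized eigenvector, hence an eigenvector, so
    -- that multiple is zero.
    obtain ⟨z, hz⟩ : (μ.snd - star μ.snd) • stVec y ∈ LinearMap.range (T - μ.fst • 1) := by
      have h1 := Submodule.sub_mem _ (Submodule.mem_comap.mp hyL.2) (Submodule.mem_comap.mp hyG.2)
      convert h1 using 1
      simp only [LinearMap.sub_apply, LinearMap.smul_apply, Module.End.one_apply]
      module
    have hzG : z ∈ liftable T D μ.fst μ.snd := by
      rw [hL]
      refine (Module.End.mem_maxGenEigenspace _ _ _).mpr ⟨2, ?_⟩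
      rw [pow_two, Module.End.mul_apply, hz, map_smul, LinearMap.mem_ker.mp hyL.1, smul_zero]
    rw [LinearMap.mem_ker.mp hzG.1] at hz
    rcases smul_eq_zero.mp hz.symm with h0 | h0
    · exact hne (sub_eq_zero.mp h0).symm
    · exact hxJ.1 h0
  obtain ⟨r, hr⟩ := Complex.conj_eq_iff_real.mp hreal
  obtain ⟨d, hd⟩ := Complex.conj_eq_iff_real.mp hsnd_real
  have hμQ : toDQ μ = dmk (r : ℍ[ℝ]) (d : ℍ[ℝ]) := by
    rw [toDQ, hr, hd, Quaternion.coeComplex_coe, Quaternion.coeComplex_coe]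
  rw [hμQ] at hx
  have hne : Nonempty ι := by
    obtain ⟨i, -⟩ := Function.ne_iff.mp hx.1
    exact ⟨i⟩
  refine ⟨r, d, ⟨x, hx⟩, fun ν hν hνr => ?_, ?_⟩
  · obtain ⟨z, hz, hzν, hzr⟩ := exists_isStEigenvalue_adjMat hν r hνr
    have := hdom z hz (by rwa [hr])
    rwa [hzν, hr, Complex.norm_real, Real.norm_eq_abs] at this
  · refine multiplicity_eq_finrank fun w => ?_
    have hgen : w ∈ genEigenspace (stMat A) r ↔
        ((T - μ.fst • 1) ^ Fintype.card ι) (stAdjVec w) = 0 := by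
      rw [hr, hT, ← stAdjVec_pow_mulVec, stAdjVec_eq_zero_iff]
      rfl
    have hlift : stAdjVec w ∈ liftable T D μ.fst μ.snd ↔
        ∃ X, stVec X = w ∧ A *ᵥ X = fun i => X i * dmk (r : ℍ[ℝ]) (d : ℍ[ℝ]) := by
      rw [mem_liftable_iff, dmk_fst_snd]
      constructor
      · rintro ⟨U, hU, hAU⟩
        rw [← adjVec_adjVecInv U] at hU hAU
        rw [stVec_adjVec, stAdjVec_injective.eq_iff] at hU
        exact ⟨_, hU, by rw [← hμQ]; exact (adjMat_mulVec_eq_iff A _ μ).mp hAU⟩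
      · rintro ⟨X, hX, hAX⟩
        rw [← hμQ] at hAX
        exact ⟨adjVec X, by rw [stVec_adjVec, hX], (adjMat_mulVec_eq_iff A X μ).mpr hAX⟩
    rw [← hlift, hgen]
    constructor
    · intro h0
      rw [hL]
      exact (Module.End.mem_maxGenEigenspace _ _ _).mpr ⟨_, h0⟩
    · intro h0
      -- The exponent `Fintype.card ι` must be at least one for eigenvectors to be killed.
      obtain ⟨k, hk⟩ := Nat.exists_eq_succ_of_ne_zero (Fintype.card_ne_zero (α := ι))
      rw [hk, pow_succ, Module.End.mul_apply, LinearMap.mem_ker.mp h0.1, map_zero]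

end AdjointMap

/-! ### Invariants of similarity -/

section Similarity

lemma eq_of_similar_complex {p q : DualNumber ℂ} (h : Similar p q) : p = q := by
  obtain ⟨u, hu, rfl⟩ := h
  rw [mul_right_comm, hu, one_mul]

lemma re_snd_mul_comm (p q : DualNumber ℍ[ℝ]) : (p * q).snd.re = (q * p).snd.re := by
  simp; ring

/-- The real part of the dual part behaves like a trace, and `u^*` is a two-sided inverse of `u`.
This invariant separates `μ` from `μ + ε`. -/
lemma re_snd_eq_of_similar {p q : DualNumber ℍ[ℝ]} (h : Similar p q) :
    p.snd.re = q.snd.re := by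
  obtain ⟨u, hu, rfl⟩ := h
  have hunit : IsUnit u := by
    rw [TrivSqZeroExt.isUnit_iff_isUnit_fst, isUnit_iff_ne_zero]
    intro h0
    have := congrArg TrivSqZeroExt.fst hu
    simp [h0] at this
  obtain ⟨w, hw⟩ := hunit.exists_right_inv
  have hu' : u * dconj u = 1 := by rwa [left_inv_eq_right_inv hu hw]
  rw [mul_assoc, re_snd_mul_comm, mul_assoc, hu', mul_one]

end Similarity

/-! ### From dual convergence to standard parts -/

section Conclusions

variable {ι : Type*} [Fintype ι]

lemma norm_stVec_sub_le_complex (v x : ι → DualNumber ℂ) :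
    ‖stVec v - stVec x‖ ≤ norm2R (v - x) :=
  (norm_le_norm2 _).trans (norm2_stVec_le_norm2R (v - x))

lemma norm_stVec_sub_le_quaternion (w : ι ⊕ ι → DualNumber ℂ) (x : ι → DualNumber ℍ[ℝ]) :
    ‖stVec w - stVec (adjVec x)‖ ≤ norm2R (adjVecInv w - x) := by
  have h : stVec w - stVec (adjVec x) = stAdjVec (stVec (adjVecInv w - x)) := by
    rw [← stVec_adjVec, adjVec_sub, adjVec_adjVecInv]
    rfl
  rw [h]
  exact (norm_stAdjVec_le _).trans (norm2_stVec_le_norm2R _)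

lemma infinite_of_forall_dmk {P : DualNumber ℂ → Prop} {μ : DualNumber ℂ}
    (h : ∀ d, P (dmk μ.fst d)) : ¬ {ν | P ν ∧ ν.fst = μ.fst}.Finite := by
  intro hfin
  refine Set.infinite_univ (α := ℂ)
    ((hfin.preimage (f := dmk μ.fst) ?_).subset fun d _ => ⟨h d, fst_dmk _ _⟩)
  intro a _ b _ hab
  simpa [snd_dmk] using congrArg TrivSqZeroExt.snd hab

end Conclusions

end DualPM

theorem theorem3p10 (n : ℕ) :
    (∀ A : Matrix (Fin n) (Fin n) (DualNumber ℂ), ¬ DualPM.ComplexAssumption A →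
      ∃ S : Set (Submodule ℂ (Fin n → ℂ)), S.Finite ∧ (∀ W ∈ S, W ≠ ⊤) ∧
        ∀ v0 : Fin n → DualNumber ℂ, (∀ W ∈ S, DualPM.stVec v0 ∉ W) →
          ∀ μ : DualNumber ℂ,
            (DualPM.IsStrictDominant A μ → ¬ DualPM.PMConverges A v0 μ) ∧
            ({ν : DualNumber ℂ | DualPM.IsEigenvalue A ν ∧ ν.fst = μ.fst}.Finite →
              ¬ DualPM.PMConverges A v0 μ) ∧
            ¬ DualPM.PMConvergesLinearly A v0 μ) ∧
    (∀ A : Matrix (Fin n) (Fin n) (DualNumber ℍ[ℝ]), ¬ DualPM.QuaternionAssumption A →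
      ∃ S : Set (Submodule ℂ (Fin n ⊕ Fin n → ℂ)), S.Finite ∧ (∀ W ∈ S, W ≠ ⊤) ∧
        ∀ v0 : Fin n → DualNumber ℍ[ℝ], (∀ W ∈ S, DualPM.stVec (DualPM.adjVec v0) ∉ W) →
          ∀ μ : DualNumber ℂ,
            (DualPM.IsStrictDominant A (DualPM.toDQ μ) → ¬ DualPM.AdjPMConverges A v0 μ) ∧
            ({ν : DualNumber ℂ | DualPM.IsEigenvalue A (DualPM.toDQ ν) ∧ ν.fst = μ.fst}.Finite →
              ¬ DualPM.AdjPMConverges A v0 μ) ∧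
            ¬ DualPM.AdjPMConvergesLinearly A v0 μ) := by
  open DualPM in
  have hpow : ∀ {c : ℝ}, 0 < c → c < 1 → Tendsto (fun k : ℕ => c ^ k) atTop (𝓝 0) :=
    fun hc hc1 => tendsto_pow_atTop_nhds_zero_of_lt_one hc.le hc1
  constructor
  · intro A hA
    obtain ⟨S, hS, hS', H⟩ := exists_exceptional_of_not_complexAssumption hA
    refine ⟨S, hS, hS', fun v0 hv μ => ?_⟩
    have key : PMConverges A v0 μ → ∀ d, IsEigenvalue A (dmk μ.fst d) := by
      rintro ⟨hnb, X, hX, hlim, -⟩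
      exact (H v0 hv hnb μ X hX (squeeze_zero_norm
        (fun k => norm_stVec_sub_le_complex (pmVec A v0 k) (X k)) hlim)).1
    refine ⟨fun hdom hconv => ?_, fun hfin hconv => infinite_of_forall_dmk (key hconv) hfin, ?_⟩
    -- The eigenvalue `μ + ε` is not similar to `μ` but has the same standard part, against strict
    -- dominance.
    · have h1 := hdom.2 (dmk μ.fst (μ.snd + 1)) (key hconv _) fun hs => by
        have := congrArg TrivSqZeroExt.snd (eq_of_similar_complex hs)
        simp [snd_dmk] at this
      simp [fst_dmk] at h1
    · rintro ⟨hnb, X, hX, c, hc, hc1, hO, -⟩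
      have hO' : (fun k => stVec (pmVec A v0 k) - stVec (X k)) =O[atTop] fun k : ℕ => c ^ k :=
        (IsBigO.of_norm_le fun k => norm_stVec_sub_le_complex (pmVec A v0 k) (X k)).trans hO
      exact (H v0 hv hnb μ X hX (hO'.trans_tendsto (hpow hc hc1))).2 c hc hc1 hO'
  · intro A hA
    obtain ⟨S, hS, hS', H⟩ := exists_exceptional_of_not_complexAssumption
      (A := adjMat A) fun h => hA (quaternionAssumption_of_complexAssumption_adjMat h)
    refine ⟨S, hS, hS', fun v0 hv μ => ?_⟩
    have key : AdjPMConverges A v0 μ → ∀ d, IsEigenvalue A (toDQ (dmk μ.fst d)) := by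
      rintro ⟨hnb, X, hX, hlim, -⟩ d
      rw [← isEigenvalue_adjMat_iff]
      exact (H (adjVec v0) hv hnb μ (fun k => adjVec (X k))
        (fun k => (isEigenpair_adjMat_iff A (X k) μ).mpr (hX k)) (squeeze_zero_norm
        (fun k => norm_stVec_sub_le_quaternion (pmVec (adjMat A) (adjVec v0) k) (X k)) hlim)).1 d
    refine ⟨fun hdom hconv => ?_, fun hfin hconv =>
      infinite_of_forall_dmk (P := fun ν => IsEigenvalue A (toDQ ν)) (key hconv) hfin, ?_⟩
    · have h1 := hdom.2 (toDQ (dmk μ.fst (μ.snd + 1))) (key hconv _) fun hs => by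
        have := re_snd_eq_of_similar hs
        simp [toDQ, snd_dmk] at this
      simp [toDQ, fst_dmk] at h1
    · rintro ⟨hnb, X, hX, c, hc, hc1, hO, -⟩
      have hO' : (fun k => stVec (pmVec (adjMat A) (adjVec v0) k) - stVec (adjVec (X k)))
          =O[atTop] fun k : ℕ => c ^ k :=
        (IsBigO.of_norm_le fun k =>
          norm_stVec_sub_le_quaternion (pmVec (adjMat A) (adjVec v0) k) (X k)).trans hO
      exact (H (adjVec v0) hv hnb μ (fun k => adjVec (X k))
        (fun k => (isEigenpair_adjMat_iff A (X k) μ).mpr (hX k))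
        (hO'.trans_tendsto (hpow hc hc1))).2 c hc hc1 hO'
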